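/- Let $\rho=\rho_{A_1A_2}\otimes\rho_{A_3A_4}$ be a four-qubit state, where $\rho_{A_1A_2}$ and $\rho_{A_3A_4}$ are two-qubit states (density matrices). A state $\rho$ of several qubits is called 2-UDA if every state $\sigma$ of the same qubits that has the same marginals as $\rho$ on all pairs of qubits equals $\rho$. Two states are LU equivalent if one is obtained from the other by conjugation with a tensor product of unitaries, one on each qubit. Write $\rho_{S}$ for the marginal of $\rho$ on the set $S$ of qubits. For real $q_1,q_2,q_3$ and complex $x,y,z$ let, in the basis $|00\rangle,|01\rangle,|10\rangle,|11\rangle$, $$D\oplus 0=\begin{bmatrix} q_1 & y & z & 0\\ y^* & q_2 & x & 0\\ z^* & x^* & q_3 & 0\\ 0&0&0&0\end{bmatrix}.$$ Then $\rho$ is 2-UDA if and only if at least one of the following conditions holds: (i) $\rho_{A_1A_2}$ or $\rho_{A_3A_4}$ is pure; (ii) at least one of $\rho_{A_1},\rho_{A_2}$ is pure and at least one of $\rho_{A_3},\rho_{A_4}$ is pure; (iii) exactly one of the four 1-marginals is pure, say $\rho_{A_j}$, and, for some labelling $\{j,n,m_1,m_2\}=\{1,2,3,4\}$ of the remaining qubits,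 $\rho=\rho_{A_j}\otimes\rho_{A_n}\otimes\rho_{A_{m_1}A_{m_2}}$ (each factor acting on the qubits that it names), where $\rho_{A_{m_1}A_{m_2}}$ has rank $2$ and is LU equivalent to some $D\oplus 0$ with $q_1q_2q_3>0$; (iv) $\rho_{A_1A_2}$ and $\rho_{A_3A_4}$ both have rank $2$, and $\rho$ is LU equivalent to some $$(H\oplus 0)_{A_1A_2}\otimes(D\oplus 0)_{A_3A_4},\qquad H\oplus 0=\begin{bmatrix} p_1 & b & c & 0\\ b^* & p_2 & a & 0\\ c^* & a^* & p_3 & 0\\ 0&0&0&0\end{bmatrix},$$ with $p_1,p_2,p_3$ real, $a,b,c$ complex, $p_1p_2p_3>0$ and $q_1q_2q_3>0$. -/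

import Mathlib

open scoped Matrix ComplexOrder

noncomputable section

/-- Operators on `n` qubits, as matrices in the computational basis `|x₀ x₁ … ⟩`, `x : Fin n → Fin 2`. -/
abbrev QubitOp (n : ℕ) : Type := Matrix (Fin n → Fin 2) (Fin n → Fin 2) ℂ

/-- A state is a density matrix: positive semidefinite with trace one. -/
def IsState {n : ℕ} (ρ : QubitOp n) : Prop :=
  ρ.PosSemidef ∧ ρ.trace = 1

/-- A pure state is `|ψ⟩⟨ψ|` for a unit vector `ψ`. -/
def IsPure {n : ℕ} (ρ : QubitOp n) : Prop :=
  ∃ ψ : (Fin n → Fin 2) → ℂ, ∑ x, ‖ψ x‖ ^ 2 = 1 ∧ ρ = Matrix.vecMulVec ψ (star ψ)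

/-- The marginal of `ρ` on the (distinct) qubits `s 0, s 1, …`, listed in this order:
all the other qubits are traced out. -/
def marginal {n k : ℕ} (s : Fin k → Fin n) (ρ : QubitOp n) : QubitOp k :=
  Matrix.of fun a b => ∑ x : Fin n → Fin 2, ∑ y : Fin n → Fin 2,
    if x ∘ s = a ∧ y ∘ s = b ∧ ∀ i, (∀ j, s j ≠ i) → x i = y i then ρ x y else 0

/-- `σ` has the same `k`-partite marginals as `ρ`. -/
def IsCompatible {n : ℕ} (k : ℕ) (σ ρ : QubitOp n) : Prop :=
  ∀ s : Fin k → Fin n, Function.Injective s → marginal s σ = marginal s ρ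

/-- `ρ` is `k`-uniquely determined among all states. -/
def IsUDA {n : ℕ} (k : ℕ) (ρ : QubitOp n) : Prop :=
  ∀ σ : QubitOp n, IsState σ → IsCompatible k σ ρ → σ = ρ

/-- The tensor product `α ⊗ β`, with `α` on the first `m` qubits and `β` on the last `n`. -/
def tensor {m n : ℕ} (α : QubitOp m) (β : QubitOp n) : QubitOp (m + n) :=
  Matrix.of fun x y =>
    α (x ∘ Fin.castAdd n) (y ∘ Fin.castAdd n) * β (x ∘ Fin.natAdd m) (y ∘ Fin.natAdd m)

/-- The product operator `U₀ ⊗ U₁ ⊗ ⋯`. -/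
def localOp {n : ℕ} (U : Fin n → Matrix (Fin 2) (Fin 2) ℂ) : QubitOp n :=
  Matrix.of fun x y => ∏ i, U i (x i) (y i)

/-- Equivalence under local unitaries, one on each qubit. -/
def LUEquiv {n : ℕ} (ρ σ : QubitOp n) : Prop :=
  ∃ U : Fin n → Matrix (Fin 2) (Fin 2) ℂ, (∀ i, U i ∈ Matrix.unitaryGroup (Fin 2) ℂ) ∧
    σ = localOp U * ρ * (localOp U)ᴴ

/-- The two-qubit operator `D ⊕ 0` in the ordered basis `|00⟩, |01⟩, |10⟩, |11⟩`. -/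
def blockZero (q₁ q₂ q₃ : ℝ) (x y z : ℂ) : QubitOp 2 :=
  (!![(q₁ : ℂ), y, z, 0;
      star y, (q₂ : ℂ), x, 0;
      star z, star x, (q₃ : ℂ), 0;
      0, 0, 0, 0] : Matrix (Fin 4) (Fin 4) ℂ).submatrix
    (fun i => finProdFinEquiv (i 0, i 1)) (fun i => finProdFinEquiv (i 0, i 1))

end

/-! Write ρ = α ⊗ β. Call an operator on a pair of qubits a correlation on α if it is supported on
the range of α and both its one-qubit marginals vanish. When neither factor is pure, ρ is 2-UDA
exactly when neither α nor β carries a nonzero correlation; the listed conditions then come from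
classifying the two-qubit states without correlations.

Sufficiency: let σ be a compatible state and M = σ - ρ. Since σ ≥ 0 has marginal α on A₁A₂, every
slice of M with fixed indices on A₃A₄ is supported on α (`SupportedOn.slice`), and symmetrically for
β. Tracing one qubit of A₃A₄ out of M leaves slices on A₁A₂ that are correlations on α, so they
vanish; then the slices of M on A₃A₄ are correlations on β, and M = 0 (`isUDA_of_noCorrelation`). If
a factor is pure, each slice is a multiple of it, with coefficient an entry of a vanishing marginal
of M.

Necessity: if X is a nonzero Hermitian correlation on α and β is not pure, choose a nonzero
traceless Hermitian Z supported on β. A small multiple of X ⊗ Z added to ρ gives another state with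
the same two-qubit marginals (`not_isUDA_of_perturbation`).

Classification (`isPure_marginal_or_luEquiv_blockZero`): correlations form a 9-dimensional real
space of Hermitian operators, and killing one kernel vector costs 8 real equations, so a state of
rank at least 3 carries a correlation. In rank 2 the kernel contains a product vector, which local
unitaries move to |11⟩; the state becomes D ⊕ 0. If q₁ = 0 there is a correlation |01⟩⟨10| + h.c.;
if q₂ or q₃ is 0 a one-qubit marginal is pure; otherwise q₁q₂q₃ > 0. Conversely, a pure marginal, or
rank at most 2 with the form D ⊕ 0 and q₁ ≠ 0, excludes correlations
(`noCorrelation_of_isPure_marginal`, `noCorrelation_of_corner`). -/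

/-! ### Operators supported on a positive matrix -/

/-- The support of `X` and the support of its adjoint lie in the range of the Hermitian matrix `α`. -/
def SupportedOn {P : Type*} [Fintype P] (X α : Matrix P P ℂ) : Prop :=
  (∀ v, α *ᵥ v = 0 → X *ᵥ v = 0) ∧ ∀ v, α *ᵥ v = 0 → Xᴴ *ᵥ v = 0

namespace SupportedOn

variable {P : Type*} [Fintype P] {X Y α : Matrix P P ℂ}

theorem sub (hX : SupportedOn X α) (hY : SupportedOn Y α) : SupportedOn (X - Y) α :=
  ⟨fun v hv => by rw [Matrix.sub_mulVec, hX.1 v hv, hY.1 v hv, sub_zero],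
    fun v hv => by rw [Matrix.conjTranspose_sub, Matrix.sub_mulVec, hX.2 v hv, hY.2 v hv, sub_zero]⟩

theorem sum {ι : Type*} (s : Finset ι) {X : ι → Matrix P P ℂ} (hX : ∀ i, SupportedOn (X i) α) :
    SupportedOn (∑ i ∈ s, X i) α :=
  ⟨fun v hv => by
    rw [Matrix.sum_mulVec]; exact Finset.sum_eq_zero fun i _ => (hX i).1 v hv,
   fun v hv => by
    rw [Matrix.conjTranspose_sum, Matrix.sum_mulVec]
    exact Finset.sum_eq_zero fun i _ => (hX i).2 v hv⟩

theorem of_isHermitian (hX : X.IsHermitian) (h : ∀ v, α *ᵥ v = 0 → X *ᵥ v = 0) :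
    SupportedOn X α :=
  ⟨h, by rwa [hX]⟩

theorem refl (hα : α.IsHermitian) : SupportedOn α α :=
  .of_isHermitian hα fun _ => id

theorem conj [DecidableEq P] (h : SupportedOn X α) {U : Matrix P P ℂ} (hU : Uᴴ * U = 1) :
    SupportedOn (U * X * Uᴴ) (U * α * Uᴴ) := by
  have key : ∀ v, (U * α * Uᴴ) *ᵥ v = 0 → α *ᵥ (Uᴴ *ᵥ v) = 0 := by
    intro v hv
    have h1 : Uᴴ *ᵥ ((U * α * Uᴴ) *ᵥ v) = 0 := by rw [hv, Matrix.mulVec_zero]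
    rw [Matrix.mulVec_mulVec, ← Matrix.mul_assoc, ← Matrix.mul_assoc, hU, Matrix.one_mul] at h1
    rwa [Matrix.mulVec_mulVec]
  refine ⟨fun v hv => ?_, fun v hv => ?_⟩
  · rw [← Matrix.mulVec_mulVec, ← Matrix.mulVec_mulVec, h.1 _ (key v hv), Matrix.mulVec_zero]
  · rw [Matrix.conjTranspose_mul, Matrix.conjTranspose_mul, Matrix.conjTranspose_conjTranspose,
      ← Matrix.mul_assoc, ← Matrix.mulVec_mulVec, ← Matrix.mulVec_mulVec, h.2 _ (key v hv),
      Matrix.mulVec_zero]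

end SupportedOn

/-- The trace over the second tensor factor. -/
def ptrace {P Q : Type*} [Fintype Q] (M : Matrix (P × Q) (P × Q) ℂ) : Matrix P P ℂ :=
  Matrix.of fun p p' => ∑ q, M (p, q) (p', q)

/-- If the partial trace of τ kills v, the values of the quadratic form of τ at the vectors v ⊗ e_r
sum to zero. They are nonnegative, so each vanishes, and positivity makes τ kill every v ⊗ e_r;
hence so does X. -/
theorem SupportedOn.slice {P Q : Type*} [Fintype P] [Fintype Q]
    {τ X : Matrix (P × Q) (P × Q) ℂ} (hτ : τ.PosSemidef) (h : SupportedOn X τ) (q q' : Q) :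
    SupportedOn (Matrix.of fun p p' => X (p, q) (p', q')) (ptrace τ) := by
  classical
  have key : ∀ Y : Matrix (P × Q) (P × Q) ℂ, (∀ v, τ *ᵥ v = 0 → Y *ᵥ v = 0) →
      ∀ v, ptrace τ *ᵥ v = 0 → ∀ q q' : Q,
      (Matrix.of fun p p' => Y (p, q) (p', q')) *ᵥ v = 0 := by
    intro Y hY v hv q q'
    set w : Q → P × Q → ℂ := fun r x => if x.2 = r then v x.1 else 0 with hw
    have hmul : ∀ (Y : Matrix (P × Q) (P × Q) ℂ) r x,
        (Y *ᵥ w r) x = ∑ p, Y x (p, r) * v p := by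
      intro Y r x
      simp [Matrix.mulVec, dotProduct, hw, Fintype.sum_prod_type]
    have hsum : ∑ r, star (w r) ⬝ᵥ (τ *ᵥ w r) = star v ⬝ᵥ (ptrace τ *ᵥ v) := by
      have : ∀ r, star (w r) ⬝ᵥ (τ *ᵥ w r) =
          ∑ p, star (v p) * ∑ p', τ (p, r) (p', r) * v p' := by
        intro r
        simp only [dotProduct, Pi.star_apply, Fintype.sum_prod_type]
        refine Finset.sum_congr rfl fun p _ => ?_
        rw [Finset.sum_eq_single r (by simp +contextual [hw]) (by simp), hmul]
        simp [hw]
      simp only [this]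
      rw [Finset.sum_comm]
      simp only [dotProduct, Matrix.mulVec, ptrace, Matrix.of_apply, Pi.star_apply]
      refine Finset.sum_congr rfl fun p _ => ?_
      rw [← Finset.mul_sum, Finset.sum_comm]
      simp only [Finset.sum_mul]
    rw [hv, dotProduct_zero] at hsum
    have h0 := (Finset.sum_eq_zero_iff_of_nonneg
      (fun r _ => hτ.dotProduct_mulVec_nonneg (w r))).1 hsum q' (Finset.mem_univ _)
    have h1 := hY _ ((hτ.dotProduct_mulVec_zero_iff _).1 h0)
    ext p
    have := congrFun h1 (p, q)
    rw [hmul] at this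
    simpa [Matrix.mulVec, dotProduct] using this
  exact ⟨fun v hv => key X h.1 v hv q q', fun v hv => key Xᴴ h.2 v hv q' q⟩

/-- A matrix supported on a pure state is a multiple of it. -/
theorem SupportedOn.eq_trace_smul {P : Type*} [Fintype P] {X : Matrix P P ℂ} {ψ : P → ℂ}
    (hψ : ∑ x, ‖ψ x‖ ^ 2 = 1) (h : SupportedOn X (Matrix.vecMulVec ψ (star ψ))) :
    X = X.trace • Matrix.vecMulVec ψ (star ψ) := by
  classical
  have hn : star ψ ⬝ᵥ ψ = 1 := by
    have : star ψ ⬝ᵥ ψ = ((∑ x, ‖ψ x‖ ^ 2 : ℝ) : ℂ) := by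
      simp [dotProduct, Complex.conj_mul']
    rw [this, hψ, Complex.ofReal_one]
  set R := Matrix.vecMulVec ψ (star ψ) with hR
  have hRR : R * R = R := by
    rw [hR, Matrix.vecMulVec_mul_vecMulVec, hn, one_smul]
  have hRH : Rᴴ = R := by
    rw [hR, Matrix.conjTranspose_vecMulVec, star_star]
  -- R is an orthogonal projection, so the columns of 1 - R lie in its kernel and Y kills them.
  have key : ∀ Y : Matrix P P ℂ, (∀ v, R *ᵥ v = 0 → Y *ᵥ v = 0) → Y * R = Y := by
    intro Y hY
    have : Y * (1 - R) = 0 := by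
      ext i j
      have h1 : R *ᵥ ((1 - R).col j) = 0 := by
        rw [← Matrix.mulVec_single_one, Matrix.mulVec_mulVec, Matrix.mul_sub, hRR, Matrix.mul_one,
          sub_self, Matrix.zero_mulVec]
      have h2 := congrFun (hY _ h1) i
      simpa [Matrix.mul_apply, Matrix.mulVec, dotProduct] using h2
    rw [Matrix.mul_sub, Matrix.mul_one, sub_eq_zero] at this
    exact this.symm
  have h1 := key X h.1
  have h2 := key Xᴴ h.2
  have h3 : R * X = X := by
    have := congrArg Matrix.conjTranspose h2
    rwa [Matrix.conjTranspose_mul, Matrix.conjTranspose_conjTranspose, hRH] at this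
  have h4 : X = (star ψ ⬝ᵥ (X *ᵥ ψ)) • R := by
    conv_lhs => rw [← h3, ← h1, hR, Matrix.mul_vecMulVec, Matrix.vecMulVec_mul_vecMulVec,
      Matrix.vecMulVec_smul]
  have h5 : X.trace = star ψ ⬝ᵥ (X *ᵥ ψ) := by
    conv_lhs => rw [h4]
    rw [Matrix.trace_smul, hR, Matrix.trace_vecMulVec, dotProduct_comm ψ, hn, smul_eq_mul, mul_one]
  rw [h5]
  exact h4

/-! ### Perturbing a state inside its support -/

/-- X has zero rows and columns wherever d vanishes, so its quadratic form is bounded by a constant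
times that of the diagonal matrix; a small enough multiple cannot destroy positivity. -/
theorem exists_perturb_diagonal {P : Type*} [Fintype P] [DecidableEq P] {d : P → ℝ}
    (hd : ∀ i, 0 ≤ d i) {X : Matrix P P ℂ} (hX : X.IsHermitian)
    (h : SupportedOn X (Matrix.diagonal fun i => (d i : ℂ))) :
    ∃ ε : ℝ, 0 < ε ∧ ∀ s : ℝ, |s| ≤ ε →
      (Matrix.diagonal (fun i => (d i : ℂ)) + (s : ℂ) • X).PosSemidef := by
  have hcol : ∀ i j, d j = 0 → X i j = 0 := by
    intro i j hj
    have h1 : Matrix.diagonal (fun i => (d i : ℂ)) *ᵥ Pi.single j 1 = 0 := by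
      ext k
      by_cases hk : k = j
      · subst hk; simp [hj]
      · simp [Matrix.diagonal, hk]
    have := congrFun (h.1 _ h1) i
    simpa using this
  have hrow : ∀ i j, d i = 0 → X i j = 0 := by
    intro i j hi
    rw [← hX.apply i j, hcol j i hi, star_zero]
  -- One constant with ‖X i j‖ ≤ C d i and ‖X i j‖ ≤ C d j. Where d i = 0 the inverse is 0 by
  -- convention, but there the row and column of X vanish.
  set C : ℝ := ∑ i, ∑ j, ‖X i j‖ * ((d i)⁻¹ + (d j)⁻¹) with hC
  have hterm : ∀ i j, 0 ≤ ‖X i j‖ * ((d i)⁻¹ + (d j)⁻¹) := fun i j =>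
    mul_nonneg (norm_nonneg _) (add_nonneg (inv_nonneg.2 (hd i)) (inv_nonneg.2 (hd j)))
  have hle : ∀ i j, ‖X i j‖ * ((d i)⁻¹ + (d j)⁻¹) ≤ C := fun i j =>
    (Finset.single_le_sum (f := fun j => ‖X i j‖ * ((d i)⁻¹ + (d j)⁻¹))
      (fun j _ => hterm i j) (Finset.mem_univ j)).trans
    (Finset.single_le_sum (f := fun i => ∑ j, ‖X i j‖ * ((d i)⁻¹ + (d j)⁻¹))
      (fun i _ => Finset.sum_nonneg fun j _ => hterm i j) (Finset.mem_univ i))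
  have hC0 : 0 ≤ C := Finset.sum_nonneg fun i _ => Finset.sum_nonneg fun j _ => hterm i j
  have hbi : ∀ i j, ‖X i j‖ ≤ C * d i := by
    intro i j
    rcases (hd i).eq_or_lt with hi | hi
    · rw [hrow i j hi.symm, ← hi]; simp
    · rw [← div_le_iff₀ hi, div_eq_mul_inv]
      refine le_trans ?_ (hle i j)
      exact mul_le_mul_of_nonneg_left (le_add_of_nonneg_right (inv_nonneg.2 (hd j))) (norm_nonneg _)
  have hbj : ∀ i j, ‖X i j‖ ≤ C * d j := by
    intro i j
    rw [← hX.apply i j, norm_star]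
    exact hbi j i
  set K : ℝ := C * Fintype.card P with hK
  have hK0 : 0 ≤ K := mul_nonneg hC0 (Nat.cast_nonneg _)
  have hquad : ∀ x : P → ℂ, ‖star x ⬝ᵥ (X *ᵥ x)‖ ≤ K * ∑ i, d i * ‖x i‖ ^ 2 := by
    intro x
    have h1 : ‖star x ⬝ᵥ (X *ᵥ x)‖ ≤
        ∑ i, ∑ j, (C / 2) * (d i * ‖x i‖ ^ 2 + d j * ‖x j‖ ^ 2) := by
      simp only [dotProduct, Matrix.mulVec, Pi.star_apply]
      refine (norm_sum_le _ _).trans (Finset.sum_le_sum fun i _ => ?_)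
      rw [norm_mul, norm_star]
      refine (mul_le_mul_of_nonneg_left (norm_sum_le _ _) (norm_nonneg _)).trans ?_
      rw [Finset.mul_sum]
      refine Finset.sum_le_sum fun j _ => ?_
      rw [norm_mul]
      have a1 := mul_le_mul_of_nonneg_right (hbi i j) (sq_nonneg ‖x i‖)
      have a2 := mul_le_mul_of_nonneg_right (hbj i j) (sq_nonneg ‖x j‖)
      have a3 := mul_nonneg (norm_nonneg (X i j)) (sq_nonneg (‖x i‖ - ‖x j‖))
      nlinarith
    refine h1.trans_eq ?_
    have gen : ∀ f : P → ℝ, ∑ i, ∑ j, (C / 2) * (f i + f j) = K * ∑ i, f i := by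
      intro f
      simp only [← Finset.mul_sum, Finset.sum_add_distrib, Finset.sum_const, Finset.card_univ,
        nsmul_eq_mul, hK]
      ring
    exact gen fun i => d i * ‖x i‖ ^ 2
  -- K + 1 instead of K keeps ε positive and meaningful when X = 0.
  refine ⟨(K + 1)⁻¹, by positivity, fun s hs => ?_⟩
  have hherm : (Matrix.diagonal (fun i => (d i : ℂ)) + (s : ℂ) • X).IsHermitian := by
    refine Matrix.IsHermitian.add (Matrix.isHermitian_diagonal_of_self_adjoint _ ?_) ?_
    · ext i; simp
    · rw [Matrix.IsHermitian, Matrix.conjTranspose_smul, hX]; simp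
  refine .of_dotProduct_mulVec_nonneg hherm fun x => ?_
  rw [Complex.nonneg_iff]
  refine ⟨?_, (hherm.im_star_dotProduct_mulVec_self x).symm⟩
  have hdiag : star x ⬝ᵥ (Matrix.diagonal (fun i => (d i : ℂ)) *ᵥ x) =
      ((∑ i, d i * ‖x i‖ ^ 2 : ℝ) : ℂ) := by
    simp only [dotProduct, Matrix.mulVec_diagonal, Pi.star_apply, Complex.ofReal_sum,
      Complex.ofReal_mul, Complex.ofReal_pow, ← Complex.conj_mul']
    refine Finset.sum_congr rfl fun i _ => ?_
    rw [← starRingEnd_apply]; ring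
  rw [Matrix.add_mulVec, Matrix.smul_mulVec, dotProduct_add, dotProduct_smul, hdiag,
    Complex.add_re, Complex.ofReal_re, smul_eq_mul, Complex.re_ofReal_mul]
  set S := ∑ i, d i * ‖x i‖ ^ 2
  have hS : 0 ≤ S := Finset.sum_nonneg fun i _ => mul_nonneg (hd i) (sq_nonneg _)
  have h2 : |s * (star x ⬝ᵥ X *ᵥ x).re| ≤ (K + 1)⁻¹ * (K * S) := by
    rw [abs_mul]
    exact mul_le_mul hs ((Complex.abs_re_le_norm _).trans (hquad x)) (abs_nonneg _) (by positivity)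
  have h3 : (K + 1)⁻¹ * (K * S) ≤ S := by
    rw [inv_mul_le_iff₀ (by positivity)]; nlinarith
  linarith [neg_abs_le (s * (star x ⬝ᵥ X *ᵥ x).re)]

theorem spectral_decomp {P : Type*} [Fintype P] [DecidableEq P] {α : Matrix P P ℂ}
    (hα : α.IsHermitian) :
    ∃ V : Matrix P P ℂ, Vᴴ * V = 1 ∧ V * Vᴴ = 1 ∧
      V * Matrix.diagonal (fun i => (hα.eigenvalues i : ℂ)) * Vᴴ = α := by
  refine ⟨hα.eigenvectorUnitary, ?_, ?_, ?_⟩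
  · exact Unitary.coe_star_mul_self hα.eigenvectorUnitary
  · exact Unitary.coe_mul_star_self hα.eigenvectorUnitary
  · conv_rhs => rw [hα.spectral_theorem]
    rfl

theorem exists_perturb {P : Type*} [Fintype P] {α X : Matrix P P ℂ}
    (hα : α.PosSemidef) (hX : X.IsHermitian) (h : SupportedOn X α) :
    ∃ ε : ℝ, 0 < ε ∧ ∀ s : ℝ, |s| ≤ ε → (α + (s : ℂ) • X).PosSemidef := by
  classical
  obtain ⟨V, hV, hV', hα'⟩ := spectral_decomp hα.isHermitian
  have hD : Vᴴ * α * V = Matrix.diagonal (fun i => (hα.isHermitian.eigenvalues i : ℂ)) := by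
    conv_lhs => rw [← hα', Matrix.mul_assoc, Matrix.mul_assoc, hV, ← Matrix.mul_assoc,
      ← Matrix.mul_assoc, hV, Matrix.one_mul, Matrix.mul_one]
  have hsupp : SupportedOn (Vᴴ * X * V)
      (Matrix.diagonal (fun i => (hα.isHermitian.eigenvalues i : ℂ))) := by
    have := h.conj (U := Vᴴ) (by rwa [Matrix.conjTranspose_conjTranspose])
    rwa [Matrix.conjTranspose_conjTranspose, hD] at this
  obtain ⟨ε, hε, hs⟩ := exists_perturb_diagonal hα.eigenvalues_nonneg
    (Matrix.isHermitian_conjTranspose_mul_mul V hX) hsupp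
  refine ⟨ε, hε, fun s hsε => ?_⟩
  have := (hs s hsε).mul_mul_conjTranspose_same V
  rwa [Matrix.mul_add, Matrix.add_mul, hα', Matrix.mul_smul, Matrix.smul_mul,
    Matrix.mul_assoc, Matrix.mul_assoc (Vᴴ * X), hV', Matrix.mul_one, ← Matrix.mul_assoc, hV',
    Matrix.one_mul] at this

/-- The eigenvalues sum to 1. A single nonzero one would equal 1, and the state would be the
projection onto its eigenvector. -/
theorem exists_two_eigenvalues {n : ℕ} {α : QubitOp n} (hα : IsState α) (hp : ¬ IsPure α) :
    ∃ i j, i ≠ j ∧ hα.1.isHermitian.eigenvalues i ≠ 0 ∧ hα.1.isHermitian.eigenvalues j ≠ 0 := by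
  obtain ⟨V, hV, -, hα'⟩ := spectral_decomp hα.1.isHermitian
  set l := hα.1.isHermitian.eigenvalues
  have htr : ∑ i, l i = 1 := by
    have h' : ((∑ i, l i : ℝ) : ℂ) = 1 := by
      rw [← hα.2, hα.1.isHermitian.trace_eq_sum_eigenvalues]; push_cast; rfl
    exact_mod_cast h'
  obtain ⟨i, hi⟩ : ∃ i, l i ≠ 0 := by
    by_contra! hc
    simp [hc] at htr
  by_contra! hc
  have hz : ∀ j, j ≠ i → l j = 0 := fun j hj => hc i j hj.symm hi
  have hli : l i = 1 := by
    rwa [Finset.sum_eq_single i (fun j _ hj => hz j hj) (by simp)] at htr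
  refine hp ⟨fun x => V x i, ?_, ?_⟩
  · have := congrFun (congrFun hV i) i
    simp only [Matrix.mul_apply, Matrix.conjTranspose_apply, Matrix.one_apply_eq] at this
    have h' : ((∑ x, ‖V x i‖ ^ 2 : ℝ) : ℂ) = 1 := by
      rw [← this]; push_cast
      exact Finset.sum_congr rfl fun x _ => (Complex.conj_mul' _).symm
    exact_mod_cast h'
  · ext x y
    conv_lhs => rw [← hα']
    rw [Matrix.mul_apply, Finset.sum_eq_single i]
    · simp [Matrix.vecMulVec_apply, hli]
    · intro j _ hj
      simp [hz j hj]
    · simp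

theorem two_le_rank_of_not_isPure {n : ℕ} {α : QubitOp n} (hα : IsState α) (hp : ¬ IsPure α) :
    2 ≤ α.rank := by
  obtain ⟨i, j, hij, hi, hj⟩ := exists_two_eigenvalues hα hp
  rw [hα.1.isHermitian.rank_eq_card_non_zero_eigs]
  exact Fintype.one_lt_card_iff.2 ⟨⟨i, hi⟩, ⟨j, hj⟩, by simpa using hij⟩

theorem exists_traceless_supportedOn {n : ℕ} {α : QubitOp n} (hα : IsState α) (hp : ¬ IsPure α) :
    ∃ Z : QubitOp n, Z.IsHermitian ∧ SupportedOn Z α ∧ Z.trace = 0 ∧ Z ≠ 0 := by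
  obtain ⟨i, j, hij, hi, hj⟩ := exists_two_eigenvalues hα hp
  obtain ⟨V, hV, hV', hα'⟩ := spectral_decomp hα.1.isHermitian
  set l := hα.1.isHermitian.eigenvalues
  -- The difference of two eigenprojections, written in the eigenbasis: traceless, and supported
  -- where both eigenvalues are nonzero.
  set D : QubitOp n := Matrix.diagonal (Pi.single i 1 - Pi.single j 1) with hD
  have hDH : D.IsHermitian := by
    refine Matrix.isHermitian_diagonal_of_self_adjoint _ ?_
    rw [IsSelfAdjoint, star_sub, Pi.star_single, Pi.star_single, star_one]
  have hDs : SupportedOn D (Matrix.diagonal fun i => (l i : ℂ)) := by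
    refine .of_isHermitian hDH fun v hv => ?_
    ext k
    have hk := congrFun hv k
    rw [Matrix.mulVec_diagonal, Pi.zero_apply] at hk
    rw [hD, Matrix.mulVec_diagonal, Pi.zero_apply]
    by_cases hki : k = i
    · subst hki
      have : v k = 0 := by simpa [hi] using hk
      rw [this, mul_zero]
    · by_cases hkj : k = j
      · subst hkj
        have : v k = 0 := by simpa [hj] using hk
        rw [this, mul_zero]
      · simp [hki, hkj]
  refine ⟨V * D * Vᴴ, Matrix.isHermitian_mul_mul_conjTranspose V hDH, ?_, ?_, ?_⟩
  · have := hDs.conj hV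
    rwa [hα'] at this
  · rw [Matrix.trace_mul_comm, ← Matrix.mul_assoc, hV, Matrix.one_mul, hD, Matrix.trace_diagonal]
    simp
  · intro h0
    have h1 : D = 0 := by
      have : Vᴴ * (V * D * Vᴴ) * V = D := by
        rw [Matrix.mul_assoc, Matrix.mul_assoc, hV, ← Matrix.mul_assoc, ← Matrix.mul_assoc, hV,
          Matrix.one_mul, Matrix.mul_one]
      rw [← this, h0]; simp
    have := congrFun (congrFun h1 i) i
    simp [hD, hij] at this

/-! ### Marginals as partial traces, and tensor products -/

noncomputable section

/-- Configurations of `n` qubits as pairs of configurations of two complementary sets of qubits. -/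
def splitSites {k r n : ℕ} (e : Fin k ⊕ Fin r ≃ Fin n) :
    (Fin k → Fin 2) × (Fin r → Fin 2) ≃ (Fin n → Fin 2) :=
  (Equiv.sumArrowEquivProdArrow _ _ _).symm.trans (e.arrowCongr (Equiv.refl _))

end

@[simp] theorem splitSites_inl {k r n : ℕ} (e : Fin k ⊕ Fin r ≃ Fin n)
    (p : (Fin k → Fin 2) × (Fin r → Fin 2)) (i : Fin k) :
    splitSites e p (e (.inl i)) = p.1 i := by
  simp [splitSites, Equiv.arrowCongr, Equiv.sumArrowEquivProdArrow]

@[simp] theorem splitSites_inr {k r n : ℕ} (e : Fin k ⊕ Fin r ≃ Fin n)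
    (p : (Fin k → Fin 2) × (Fin r → Fin 2)) (i : Fin r) :
    splitSites e p (e (.inr i)) = p.2 i := by
  simp [splitSites, Equiv.arrowCongr, Equiv.sumArrowEquivProdArrow]

/-- Splitting the sites into kept and traced ones turns the agreement condition in `marginal` into
equality of second components, which makes positivity and slicing arguments for partial traces
available. -/
theorem marginal_eq_ptrace {k r n : ℕ} (e : Fin k ⊕ Fin r ≃ Fin n) {s : Fin k → Fin n}
    (hs : ∀ i, e (.inl i) = s i) (ρ : QubitOp n) :
    marginal s ρ = ptrace (ρ.submatrix (splitSites e) (splitSites e)) := by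
  ext a b
  have hfst : ∀ (p : (Fin k → Fin 2) × (Fin r → Fin 2)) (c : Fin k → Fin 2),
      splitSites e p ∘ s = c ↔ p.1 = c := by
    intro p c
    simp only [funext_iff, Function.comp_apply, ← hs, splitSites_inl]
  have hsnd : ∀ p q : (Fin k → Fin 2) × (Fin r → Fin 2),
      (∀ i, (∀ j, s j ≠ i) → splitSites e p i = splitSites e q i) ↔ p.2 = q.2 := by
    intro p q
    rw [← e.forall_congr_right]
    simp only [Sum.forall, ← hs, splitSites_inl, splitSites_inr, funext_iff, ne_eq,
      EmbeddingLike.apply_eq_iff_eq, Sum.inl.injEq, reduceCtorEq, not_false_eq_true, forall_const,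
      forall_eq, IsEmpty.forall_iff, implies_true, true_and]
  simp only [marginal, Matrix.of_apply, ptrace, Matrix.submatrix_apply]
  rw [← (splitSites e).sum_comp]
  simp only [← (splitSites e).sum_comp (fun y => ite _ (ρ _ y) 0), hfst, hsnd,
    Fintype.sum_prod_type]
  rw [Finset.sum_eq_single a]
  · refine Finset.sum_congr rfl fun c _ => ?_
    rw [Finset.sum_eq_single b, Finset.sum_eq_single c] <;> simp +contextual [eq_comm]
  · intro x _ hx
    simp [hx]
  · simp

theorem exists_split {k n : ℕ} {s : Fin k → Fin n} (hs : Function.Injective s) :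
    ∃ (r : ℕ) (e : Fin k ⊕ Fin r ≃ Fin n), ∀ i, e (.inl i) = s i := by
  classical
  refine ⟨Fintype.card ↥(Set.range s)ᶜ,
    ((Equiv.ofInjective s hs).sumCongr (Fintype.equivFin ↥(Set.range s)ᶜ).symm).trans
      (Equiv.Set.sumCompl _), fun i => by simp⟩

theorem marginal_add {n k : ℕ} (s : Fin k → Fin n) (ρ σ : QubitOp n) :
    marginal s (ρ + σ) = marginal s ρ + marginal s σ := by
  ext a b
  simp only [marginal, Matrix.of_apply, Matrix.add_apply, ← Finset.sum_add_distrib]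
  refine Finset.sum_congr rfl fun x _ => Finset.sum_congr rfl fun y _ => ?_
  split_ifs <;> simp

theorem marginal_smul {n k : ℕ} (s : Fin k → Fin n) (c : ℂ) (ρ : QubitOp n) :
    marginal s (c • ρ) = c • marginal s ρ := by
  ext a b
  simp only [marginal, Matrix.of_apply, Matrix.smul_apply, Finset.smul_sum]
  refine Finset.sum_congr rfl fun x _ => Finset.sum_congr rfl fun y _ => ?_
  split_ifs <;> simp

theorem marginal_sub {n k : ℕ} (s : Fin k → Fin n) (ρ σ : QubitOp n) :
    marginal s (ρ - σ) = marginal s ρ - marginal s σ := by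
  have h := marginal_add s (ρ - σ) σ
  rw [sub_add_cancel] at h
  rw [h, add_sub_cancel_right]

theorem marginal_comp_perm {n k : ℕ} (s : Fin k → Fin n) (π : Equiv.Perm (Fin k)) (ρ : QubitOp n) :
    marginal (s ∘ π) ρ = (marginal s ρ).submatrix (· ∘ π.symm) (· ∘ π.symm) := by
  ext a b
  have h1 : ∀ x c : Fin k → Fin 2, x ∘ π = c ↔ x = c ∘ π.symm := fun x c =>
    (Equiv.eq_comp_symm π x c).symm
  have h2 : ∀ i, (∀ j, s (π j) ≠ i) ↔ ∀ j, s j ≠ i := fun i =>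
    π.forall_congr_right (q := fun j => s j ≠ i)
  simp only [marginal, Matrix.of_apply, Matrix.submatrix_apply, ← Function.comp_assoc, h1, h2,
    Function.comp_apply]

theorem marginal_isState {n k : ℕ} {s : Fin k → Fin n} (hs : Function.Injective s) {ρ : QubitOp n}
    (hρ : IsState ρ) : IsState (marginal s ρ) := by
  classical
  obtain ⟨r, e, he⟩ := exists_split hs
  rw [marginal_eq_ptrace e he]
  have hpos := hρ.1.submatrix (splitSites e)
  constructor
  · have : ptrace (ρ.submatrix (splitSites e) (splitSites e)) =
        ∑ q, (ρ.submatrix (splitSites e) (splitSites e)).submatrix (fun p => (p, q))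
          (fun p => (p, q)) := by
      ext a b
      simp [ptrace, Matrix.sum_apply]
    rw [this]
    exact Matrix.posSemidef_sum _ fun q _ => hpos.submatrix _
  · rw [← hρ.2]
    simp only [Matrix.trace, Matrix.diag, ptrace, Matrix.of_apply, Matrix.submatrix_apply]
    rw [← (splitSites e).sum_comp, Fintype.sum_prod_type]

theorem tensor_eq_kronecker {m n : ℕ} (α : QubitOp m) (β : QubitOp n) :
    tensor α β = (Matrix.kronecker α β).submatrix (Fin.appendEquiv m n).symm
      (Fin.appendEquiv m n).symm := by
  ext x y
  rfl

theorem tensor_mul {m n : ℕ} (α α' : QubitOp m) (β β' : QubitOp n) :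
    tensor α β * tensor α' β' = tensor (α * α') (β * β') := by
  simp only [tensor_eq_kronecker]
  rw [Matrix.submatrix_mul_equiv]
  exact congrArg (fun M => Matrix.submatrix M _ _) (Matrix.mul_kronecker_mul _ _ _ _).symm

theorem tensor_conjTranspose {m n : ℕ} (α : QubitOp m) (β : QubitOp n) :
    (tensor α β)ᴴ = tensor αᴴ βᴴ := by
  ext x y
  simp [tensor]

theorem tensor_posSemidef {m n : ℕ} {α : QubitOp m} {β : QubitOp n} (hα : α.PosSemidef)
    (hβ : β.PosSemidef) : (tensor α β).PosSemidef := by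
  rw [tensor_eq_kronecker]
  exact (hα.kronecker hβ).submatrix _

theorem tensor_trace {m n : ℕ} (α : QubitOp m) (β : QubitOp n) :
    (tensor α β).trace = α.trace * β.trace := by
  rw [← Matrix.trace_kronecker, tensor_eq_kronecker]
  exact Equiv.sum_comp (Fin.appendEquiv m n).symm fun p => Matrix.kronecker α β p p

theorem tensor_isState {m n : ℕ} {α : QubitOp m} {β : QubitOp n} (hα : IsState α)
    (hβ : IsState β) : IsState (tensor α β) :=
  ⟨tensor_posSemidef hα.1 hβ.1, by rw [tensor_trace, hα.2, hβ.2, one_mul]⟩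

theorem tensor_append {m n : ℕ} (α : QubitOp m) (β : QubitOp n) (x y : Fin m → Fin 2)
    (x' y' : Fin n → Fin 2) :
    tensor α β (Fin.append x x') (Fin.append y y') = α x y * β x' y' := by
  have h1 : ∀ (u : Fin m → Fin 2) (v : Fin n → Fin 2), Fin.append u v ∘ Fin.castAdd n = u :=
    fun u v => by ext; simp
  have h2 : ∀ (u : Fin m → Fin 2) (v : Fin n → Fin 2), Fin.append u v ∘ Fin.natAdd m = v :=
    fun u v => by ext; simp
  simp only [tensor, Matrix.of_apply, h1, h2]

theorem tensor_ne_zero {m n : ℕ} {α : QubitOp m} {β : QubitOp n} (hα : α ≠ 0) (hβ : β ≠ 0) :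
    tensor α β ≠ 0 := by
  intro h
  obtain ⟨x, y, hxy⟩ : ∃ x y, α x y ≠ 0 := by
    by_contra! hc; exact hα (by ext; simp [hc])
  obtain ⟨x', y', hxy'⟩ : ∃ x y, β x y ≠ 0 := by
    by_contra! hc; exact hβ (by ext; simp [hc])
  have := congrFun (congrFun h (Fin.append x x')) (Fin.append y y')
  rw [tensor_append] at this
  exact mul_ne_zero hxy hxy' this

theorem sum_append {m n : ℕ} (f : (Fin (m + n) → Fin 2) → ℂ) :
    ∑ x, f x = ∑ x : Fin m → Fin 2, ∑ x' : Fin n → Fin 2, f (Fin.append x x') := by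
  rw [← (Fin.appendEquiv m n).sum_comp, Fintype.sum_prod_type]
  rfl

theorem marginal_tensor_append {m n k l : ℕ} (s : Fin k → Fin m) (t : Fin l → Fin n)
    (α : QubitOp m) (β : QubitOp n) :
    marginal (Fin.append (Fin.castAdd n ∘ s) (Fin.natAdd m ∘ t)) (tensor α β) =
      tensor (marginal s α) (marginal t β) := by
  ext a b
  have h1 : ∀ (x : Fin m → Fin 2) (x' : Fin n → Fin 2) (c : Fin (k + l) → Fin 2),
      Fin.append x x' ∘ Fin.append (Fin.castAdd n ∘ s) (Fin.natAdd m ∘ t) = c ↔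
        x ∘ s = c ∘ Fin.castAdd l ∧ x' ∘ t = c ∘ Fin.natAdd k := by
    intro x x' c
    simp [funext_iff, Fin.forall_fin_add]
  have hne : ∀ (i : Fin m) (j : Fin n), Fin.castAdd n i ≠ Fin.natAdd m j := fun i j h => by
    have := congrArg Fin.val h
    simp at this
    omega
  have h2 : ∀ (x y : Fin m → Fin 2) (x' y' : Fin n → Fin 2),
      (∀ i, (∀ j, Fin.append (Fin.castAdd n ∘ s) (Fin.natAdd m ∘ t) j ≠ i) →
        Fin.append x x' i = Fin.append y y' i) ↔
      (∀ i, (∀ j, s j ≠ i) → x i = y i) ∧ ∀ i, (∀ j, t j ≠ i) → x' i = y' i := by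
    intro x y x' y'
    simp [Fin.forall_fin_add, hne, (hne _ _).symm]
  have h3 : tensor (marginal s α) (marginal t β) a b =
      marginal s α (a ∘ Fin.castAdd l) (b ∘ Fin.castAdd l) *
        marginal t β (a ∘ Fin.natAdd k) (b ∘ Fin.natAdd k) := rfl
  rw [h3]
  simp only [marginal, Matrix.of_apply, sum_append, h1, h2, tensor_append, Finset.sum_mul_sum]
  refine Finset.sum_congr rfl fun x _ => Finset.sum_congr rfl fun x' _ =>
    Finset.sum_congr rfl fun y _ => Finset.sum_congr rfl fun y' _ => ?_
  rw [ite_zero_mul_ite_zero]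
  congr 1
  exact propext (by tauto)

theorem marginal_tensor_castAdd {m n k : ℕ} (s : Fin k → Fin m) (α : QubitOp m) (β : QubitOp n) :
    marginal (Fin.castAdd n ∘ s) (tensor α β) = β.trace • marginal s α := by
  ext a b
  have hne : ∀ (i : Fin m) (j : Fin n), Fin.castAdd n i ≠ Fin.natAdd m j := fun i j h => by
    have := congrArg Fin.val h
    simp at this
    omega
  have h1 : ∀ (x : Fin m → Fin 2) (x' : Fin n → Fin 2),
      Fin.append x x' ∘ Fin.castAdd n ∘ s = x ∘ s := by
    intro x x'; ext; simp
  have h2 : ∀ (x y : Fin m → Fin 2) (x' y' : Fin n → Fin 2),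
      (∀ i, (∀ j, (Fin.castAdd n ∘ s) j ≠ i) → Fin.append x x' i = Fin.append y y' i) ↔
      (∀ i, (∀ j, s j ≠ i) → x i = y i) ∧ x' = y' := by
    intro x y x' y'
    simp [Fin.forall_fin_add, hne, funext_iff]
  simp only [marginal, Matrix.of_apply, sum_append, h1, h2, tensor_append, Matrix.smul_apply,
    Matrix.trace, Matrix.diag, smul_eq_mul, Finset.mul_sum]
  refine Finset.sum_congr rfl fun x _ => ?_
  rw [Finset.sum_comm]
  refine Finset.sum_congr rfl fun y _ => ?_
  rw [Finset.sum_mul]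
  refine Finset.sum_congr rfl fun x' _ => ?_
  rw [Finset.sum_eq_single x']
  · simp only [and_true, mul_ite, mul_zero, mul_comm]
  · intro y' _ hy
    rw [if_neg]
    exact fun h => hy h.2.2.2.symm
  · simp

theorem marginal_tensor_natAdd {m n k : ℕ} (s : Fin k → Fin n) (α : QubitOp m) (β : QubitOp n) :
    marginal (Fin.natAdd m ∘ s) (tensor α β) = α.trace • marginal s β := by
  ext a b
  have hne : ∀ (i : Fin n) (j : Fin m), Fin.natAdd m i ≠ Fin.castAdd n j := fun i j h => by
    have := congrArg Fin.val h
    simp at this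
    omega
  have h1 : ∀ (x : Fin m → Fin 2) (x' : Fin n → Fin 2),
      Fin.append x x' ∘ Fin.natAdd m ∘ s = x' ∘ s := by
    intro x x'; ext; simp
  have h2 : ∀ (x y : Fin m → Fin 2) (x' y' : Fin n → Fin 2),
      (∀ i, (∀ j, (Fin.natAdd m ∘ s) j ≠ i) → Fin.append x x' i = Fin.append y y' i) ↔
      x = y ∧ ∀ i, (∀ j, s j ≠ i) → x' i = y' i := by
    intro x y x' y'
    simp [Fin.forall_fin_add, hne, funext_iff]
  simp only [marginal, Matrix.of_apply, sum_append, h1, h2, tensor_append, Matrix.smul_apply,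
    Matrix.trace, Matrix.diag, smul_eq_mul]
  rw [Finset.sum_mul]
  refine Finset.sum_congr rfl fun x _ => ?_
  rw [Finset.mul_sum]
  refine Finset.sum_congr rfl fun x' _ => ?_
  rw [Finset.mul_sum, Finset.sum_eq_single x]
  · refine Finset.sum_congr rfl fun y' _ => ?_
    simp only [true_and, mul_ite, mul_zero]
  · intro y _ hy
    refine Finset.sum_eq_zero fun y' _ => if_neg fun h => hy h.2.2.1.symm
  · simp

/-! ### Local unitaries -/

theorem localOp_mul {n : ℕ} (U V : Fin n → Matrix (Fin 2) (Fin 2) ℂ) :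
    localOp U * localOp V = localOp (fun i => U i * V i) := by
  ext x y
  simp only [localOp, Matrix.mul_apply, Matrix.of_apply, ← Finset.prod_mul_distrib]
  rw [Finset.prod_univ_sum, Fintype.piFinset_univ]

theorem localOp_one {n : ℕ} : localOp (fun _ : Fin n => 1) = 1 := by
  ext x y
  simp only [localOp, Matrix.of_apply, Matrix.one_apply, Fintype.prod_ite_zero, funext_iff,
    Finset.prod_const_one]

theorem localOp_conjTranspose {n : ℕ} (U : Fin n → Matrix (Fin 2) (Fin 2) ℂ) :
    (localOp U)ᴴ = localOp (fun i => (U i)ᴴ) := by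
  ext x y
  simp [localOp]

theorem localOp_unitary {n : ℕ} {U : Fin n → Matrix (Fin 2) (Fin 2) ℂ}
    (hU : ∀ i, U i ∈ Matrix.unitaryGroup (Fin 2) ℂ) : (localOp U)ᴴ * localOp U = 1 := by
  rw [localOp_conjTranspose, localOp_mul, ← localOp_one]
  congr 1
  ext1 i
  exact Matrix.mem_unitaryGroup_iff'.1 (hU i)

theorem localOp_unitary' {n : ℕ} {U : Fin n → Matrix (Fin 2) (Fin 2) ℂ}
    (hU : ∀ i, U i ∈ Matrix.unitaryGroup (Fin 2) ℂ) : localOp U * (localOp U)ᴴ = 1 :=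
  mul_eq_one_comm.1 (localOp_unitary hU)

theorem localOp_append {m n : ℕ} (U : Fin (m + n) → Matrix (Fin 2) (Fin 2) ℂ) :
    localOp U = tensor (localOp (U ∘ Fin.castAdd n)) (localOp (U ∘ Fin.natAdd m)) := by
  ext x y
  simp [localOp, tensor, Fin.prod_univ_add]

theorem localOp_submatrix_splitSites {k r n : ℕ} (e : Fin k ⊕ Fin r ≃ Fin n)
    (U : Fin n → Matrix (Fin 2) (Fin 2) ℂ) :
    (localOp U).submatrix (splitSites e) (splitSites e) =
      Matrix.kronecker (localOp fun i => U (e (.inl i))) (localOp fun i => U (e (.inr i))) := by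
  ext x y
  simp only [localOp, Matrix.submatrix_apply, Matrix.of_apply, Matrix.kronecker,
    Matrix.kroneckerMap_apply]
  rw [← e.prod_comp, Fintype.prod_sum_type]
  simp

/-- Cyclicity of the trace on the second factor alone: B and D meet there and cancel. -/
theorem ptrace_kronecker_conj {P Q : Type*} [Fintype P] [Fintype Q] [DecidableEq Q]
    (A C : Matrix P P ℂ) (B D : Matrix Q Q ℂ) (hDB : D * B = 1)
    (M : Matrix (P × Q) (P × Q) ℂ) :
    ptrace (Matrix.kronecker A B * M * Matrix.kronecker C D) = A * ptrace M * C := by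
  ext a b
  have hd : ∀ q q', ∑ r, D q' r * B r q = if q' = q then 1 else 0 := fun q q' => by
    rw [← Matrix.one_apply, ← hDB, Matrix.mul_apply]
  simp only [ptrace, Matrix.of_apply, Matrix.mul_apply, Matrix.kronecker,
    Matrix.kroneckerMap_apply, Fintype.sum_prod_type, Finset.sum_mul, Finset.mul_sum]
  calc _ = ∑ p', ∑ q', ∑ p, ∑ q, A a p * M (p, q) (p', q') * C p' b *
        ∑ r, D q' r * B r q := by
        rw [Finset.sum_comm]
        refine Finset.sum_congr rfl fun p' _ => ?_
        rw [Finset.sum_comm]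
        refine Finset.sum_congr rfl fun q' _ => ?_
        rw [Finset.sum_comm]
        refine Finset.sum_congr rfl fun p _ => ?_
        rw [Finset.sum_comm]
        refine Finset.sum_congr rfl fun q _ => ?_
        rw [Finset.mul_sum]
        refine Finset.sum_congr rfl fun r _ => ?_
        ring
    _ = _ := by
        refine Finset.sum_congr rfl fun p' _ => ?_
        rw [Finset.sum_comm]
        refine Finset.sum_congr rfl fun p _ => ?_
        refine Finset.sum_congr rfl fun q' _ => ?_
        simp [hd]

theorem marginal_conj {n k : ℕ} {s : Fin k → Fin n} (hs : Function.Injective s)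
    {U : Fin n → Matrix (Fin 2) (Fin 2) ℂ} (hU : ∀ i, U i ∈ Matrix.unitaryGroup (Fin 2) ℂ)
    (ρ : QubitOp n) :
    marginal s (localOp U * ρ * (localOp U)ᴴ) =
      localOp (U ∘ s) * marginal s ρ * (localOp (U ∘ s))ᴴ := by
  obtain ⟨r, e, he⟩ := exists_split hs
  rw [marginal_eq_ptrace e he, marginal_eq_ptrace e he,
    ← Matrix.submatrix_mul_equiv _ _ _ (splitSites e) _,
    ← Matrix.submatrix_mul_equiv _ _ _ (splitSites e) _, localOp_conjTranspose,
    localOp_submatrix_splitSites, localOp_submatrix_splitSites, ptrace_kronecker_conj,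
    localOp_conjTranspose]
  · have : (fun i => U (e (.inl i))) = U ∘ s := funext fun i => by rw [he]; rfl
    rw [this]
    congr 2
    funext i
    simp [he]
  · have := localOp_unitary (U := fun i => U (e (.inr i))) fun i => hU _
    rwa [localOp_conjTranspose] at this

theorem LUEquiv.symm {n : ℕ} {ρ σ : QubitOp n} (h : LUEquiv ρ σ) : LUEquiv σ ρ := by
  obtain ⟨U, hU, rfl⟩ := h
  refine ⟨fun i => (U i)ᴴ, fun i => ?_, ?_⟩
  · rw [Matrix.mem_unitaryGroup_iff', Matrix.star_eq_conjTranspose,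
      Matrix.conjTranspose_conjTranspose]
    exact Matrix.mem_unitaryGroup_iff.1 (hU i)
  · rw [← localOp_conjTranspose, Matrix.conjTranspose_conjTranspose, Matrix.mul_assoc,
      Matrix.mul_assoc, localOp_unitary hU, ← Matrix.mul_assoc, ← Matrix.mul_assoc,
      localOp_unitary hU, Matrix.one_mul, Matrix.mul_one]

theorem LUEquiv.marginal {n k : ℕ} {s : Fin k → Fin n} (hs : Function.Injective s)
    {ρ σ : QubitOp n} (h : LUEquiv ρ σ) : LUEquiv (marginal s ρ) (marginal s σ) := by
  obtain ⟨U, hU, rfl⟩ := h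
  exact ⟨U ∘ s, fun i => hU _, marginal_conj hs hU ρ⟩

theorem LUEquiv.isState {n : ℕ} {ρ σ : QubitOp n} (h : LUEquiv ρ σ) (hρ : IsState ρ) :
    IsState σ := by
  obtain ⟨U, hU, rfl⟩ := h
  refine ⟨hρ.1.mul_mul_conjTranspose_same _, ?_⟩
  rw [Matrix.trace_mul_comm, ← Matrix.mul_assoc, localOp_unitary hU, Matrix.one_mul, hρ.2]

theorem LUEquiv.rank_eq {n : ℕ} {ρ σ : QubitOp n} (h : LUEquiv ρ σ) : σ.rank = ρ.rank := by
  obtain ⟨U, hU, rfl⟩ := h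
  have h1 : IsUnit (localOp U) := .of_mul_eq_one _ (localOp_unitary' hU)
  have h2 : IsUnit (localOp U)ᴴ := .of_mul_eq_one _ (localOp_unitary hU)
  rw [Matrix.rank_mul_eq_left_of_isUnit_det _ _ ((Matrix.isUnit_iff_isUnit_det _).1 h2),
    Matrix.rank_mul_eq_right_of_isUnit_det _ _ ((Matrix.isUnit_iff_isUnit_det _).1 h1)]

theorem LUEquiv.isPure {n : ℕ} {ρ σ : QubitOp n} (h : LUEquiv ρ σ) (hρ : IsPure ρ) :
    IsPure σ := by
  obtain ⟨U, hU, rfl⟩ := h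
  obtain ⟨ψ, hψ, rfl⟩ := hρ
  refine ⟨localOp U *ᵥ ψ, ?_, ?_⟩
  · have key : ∀ φ : (Fin n → Fin 2) → ℂ, ((∑ x, ‖φ x‖ ^ 2 : ℝ) : ℂ) = star φ ⬝ᵥ φ := by
      intro φ
      simp [dotProduct, Complex.conj_mul']
    have : ((∑ x, ‖(localOp U *ᵥ ψ) x‖ ^ 2 : ℝ) : ℂ) = ((1 : ℝ) : ℂ) := by
      rw [key, ← hψ, key, Matrix.star_mulVec, Matrix.dotProduct_mulVec, Matrix.vecMul_vecMul,
        localOp_unitary hU, Matrix.vecMul_one]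
    exact_mod_cast this
  · rw [Matrix.mul_vecMulVec, Matrix.vecMulVec_mul, Matrix.star_mulVec]

/-! ### Correlation operators and explicit marginals -/

/-- `X` is supported on `α` and both its one-qubit marginals vanish. -/
def IsCorrelationOn (X α : QubitOp 2) : Prop :=
  SupportedOn X α ∧ marginal ![0] X = 0 ∧ marginal ![1] X = 0

/-- No nonzero operator supported on `α` has vanishing one-qubit marginals. -/
def NoCorrelation (α : QubitOp 2) : Prop :=
  ∀ X, IsCorrelationOn X α → X = 0

theorem IsCorrelationOn.conj {X α : QubitOp 2} (h : IsCorrelationOn X α)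
    {U : Fin 2 → Matrix (Fin 2) (Fin 2) ℂ} (hU : ∀ i, U i ∈ Matrix.unitaryGroup (Fin 2) ℂ) :
    IsCorrelationOn (localOp U * X * (localOp U)ᴴ) (localOp U * α * (localOp U)ᴴ) := by
  refine ⟨h.1.conj (localOp_unitary hU), ?_, ?_⟩
  · rw [marginal_conj (Function.injective_of_subsingleton _) hU, h.2.1, Matrix.mul_zero,
      Matrix.zero_mul]
  · rw [marginal_conj (Function.injective_of_subsingleton _) hU, h.2.2, Matrix.mul_zero,
      Matrix.zero_mul]

theorem conj_eq_zero {n : ℕ} {U : Fin n → Matrix (Fin 2) (Fin 2) ℂ}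
    (hU : ∀ i, U i ∈ Matrix.unitaryGroup (Fin 2) ℂ) {X : QubitOp n}
    (h : localOp U * X * (localOp U)ᴴ = 0) : X = 0 := by
  have h1 : (localOp U)ᴴ * (localOp U * X * (localOp U)ᴴ) * localOp U = X := by
    rw [Matrix.mul_assoc, Matrix.mul_assoc, localOp_unitary hU, ← Matrix.mul_assoc,
      ← Matrix.mul_assoc, localOp_unitary hU, Matrix.one_mul, Matrix.mul_one]
  rw [← h1, h, Matrix.mul_zero, Matrix.zero_mul]

theorem NoCorrelation.of_luEquiv {α α' : QubitOp 2} (h : NoCorrelation α') (hα : LUEquiv α α') :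
    NoCorrelation α := by
  obtain ⟨U, hU, rfl⟩ := hα
  exact fun X hX => conj_eq_zero hU (h _ (hX.conj hU))

/-- The map g reassembles a full configuration from kept and traced indices. Supplying it by hand
lets concrete marginals and slices be written with literal index vectors. -/
theorem exists_splitSites_eq {k r n : ℕ} {s : Fin k → Fin n} {t : Fin r → Fin n}
    (h : Function.Bijective (Sum.elim s t))
    {g : (Fin k → Fin 2) → (Fin r → Fin 2) → Fin n → Fin 2}
    (hs : ∀ a c i, g a c (s i) = a i) (ht : ∀ a c i, g a c (t i) = c i) :
    ∃ e : Fin k ⊕ Fin r ≃ Fin n, (∀ i, e (.inl i) = s i) ∧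
      ∀ a c, splitSites e (a, c) = g a c := by
  refine ⟨Equiv.ofBijective _ h, fun i => rfl, fun a c => ?_⟩
  ext1 i
  obtain ⟨j, rfl⟩ := (Equiv.ofBijective _ h).surjective i
  rcases j with j | j
  · rw [splitSites_inl]; exact (hs a c j).symm
  · rw [splitSites_inr]; exact (ht a c j).symm

theorem marginal_apply_of {k r n : ℕ} {s : Fin k → Fin n} {t : Fin r → Fin n}
    (h : Function.Bijective (Sum.elim s t))
    {g : (Fin k → Fin 2) → (Fin r → Fin 2) → Fin n → Fin 2}
    (hs : ∀ a c i, g a c (s i) = a i) (ht : ∀ a c i, g a c (t i) = c i) (ρ : QubitOp n)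
    (a b : Fin k → Fin 2) : marginal s ρ a b = ∑ c, ρ (g a c) (g b c) := by
  obtain ⟨e, he, hg⟩ := exists_splitSites_eq h hs ht
  simp [marginal_eq_ptrace e he, ptrace, hg]

theorem SupportedOn.slice_marginal {k r n : ℕ} {s : Fin k → Fin n} {t : Fin r → Fin n}
    (h : Function.Bijective (Sum.elim s t))
    {g : (Fin k → Fin 2) → (Fin r → Fin 2) → Fin n → Fin 2}
    (hs : ∀ a c i, g a c (s i) = a i) (ht : ∀ a c i, g a c (t i) = c i) {X ρ : QubitOp n}
    (hρ : ρ.PosSemidef) (hX : SupportedOn X ρ) (c c' : Fin r → Fin 2) :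
    SupportedOn (Matrix.of fun a b => X (g a c) (g b c')) (marginal s ρ) := by
  obtain ⟨e, he, hg⟩ := exists_splitSites_eq h hs ht
  have hX' : SupportedOn (X.submatrix (splitSites e) (splitSites e))
      (ρ.submatrix (splitSites e) (splitSites e)) := by
    have key : ∀ (Y : QubitOp n) (v : _ → ℂ), Y.submatrix (splitSites e) (splitSites e) *ᵥ v = 0 ↔
        Y *ᵥ (v ∘ (splitSites e).symm) = 0 := by
      intro Y v
      rw [Matrix.submatrix_mulVec_equiv]
      exact ⟨fun h => (splitSites e).surjective.injective_comp_right h, fun h => by rw [h]; rfl⟩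
    refine ⟨fun v hv => (key _ _).2 (hX.1 _ ((key _ _).1 hv)), fun v hv => ?_⟩
    rw [Matrix.conjTranspose_submatrix]
    exact (key _ _).2 (hX.2 _ ((key _ _).1 hv))
  have := SupportedOn.slice (hρ.submatrix (splitSites e)) hX' c c'
  rw [← marginal_eq_ptrace e he] at this
  simpa only [Matrix.submatrix_apply, hg] using this

theorem sum_qubit_one (f : (Fin 1 → Fin 2) → ℂ) : ∑ c, f c = ∑ p, f ![p] :=
  Fintype.sum_equiv (Equiv.funUnique (Fin 1) (Fin 2)) _ _ fun c =>
    congrArg f (by ext i; fin_cases i; rfl)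

theorem sum_qubit_two (f : (Fin 2 → Fin 2) → ℂ) : ∑ c, f c = ∑ p, ∑ q, f ![p, q] := by
  rw [← Fintype.sum_prod_type']
  exact Fintype.sum_equiv (finTwoArrowEquiv (Fin 2)) _ _ fun c =>
    congrArg f (by ext i; fin_cases i <;> rfl)

theorem marginal_zero_two (X : QubitOp 2) (a b : Fin 1 → Fin 2) :
    marginal ![0] X a b = ∑ p, X ![a 0, p] ![b 0, p] := by
  rw [marginal_apply_of (t := ![1]) (by decide) (g := fun a c => ![a 0, c 0])
    (by intro a c i; fin_cases i; rfl) (by intro a c i; fin_cases i; rfl), sum_qubit_one]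
  rfl

theorem marginal_one_two (X : QubitOp 2) (a b : Fin 1 → Fin 2) :
    marginal ![1] X a b = ∑ p, X ![p, a 0] ![p, b 0] := by
  rw [marginal_apply_of (t := ![0]) (by decide) (g := fun a c => ![c 0, a 0])
    (by intro a c i; fin_cases i; rfl) (by intro a c i; fin_cases i; rfl), sum_qubit_one]
  rfl

theorem marginal_zero_two_four (M : QubitOp 4) (a b : Fin 2 → Fin 2) :
    marginal ![0, 2] M a b = ∑ p, ∑ q, M ![a 0, p, a 1, q] ![b 0, p, b 1, q] := by
  rw [marginal_apply_of (t := ![1, 3]) (by decide) (g := fun a c => ![a 0, c 0, a 1, c 1])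
    (by intro a c i; fin_cases i <;> rfl) (by intro a c i; fin_cases i <;> rfl), sum_qubit_two]
  rfl

theorem marginal_zero_three_four (M : QubitOp 4) (a b : Fin 2 → Fin 2) :
    marginal ![0, 3] M a b = ∑ p, ∑ q, M ![a 0, p, q, a 1] ![b 0, p, q, b 1] := by
  rw [marginal_apply_of (t := ![1, 2]) (by decide) (g := fun a c => ![a 0, c 0, c 1, a 1])
    (by intro a c i; fin_cases i <;> rfl) (by intro a c i; fin_cases i <;> rfl), sum_qubit_two]
  rfl

theorem marginal_one_two_four (M : QubitOp 4) (a b : Fin 2 → Fin 2) :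
    marginal ![1, 2] M a b = ∑ p, ∑ q, M ![p, a 0, a 1, q] ![p, b 0, b 1, q] := by
  rw [marginal_apply_of (t := ![0, 3]) (by decide) (g := fun a c => ![c 0, a 0, a 1, c 1])
    (by intro a c i; fin_cases i <;> rfl) (by intro a c i; fin_cases i <;> rfl), sum_qubit_two]
  rfl

theorem marginal_one_three_four (M : QubitOp 4) (a b : Fin 2 → Fin 2) :
    marginal ![1, 3] M a b = ∑ p, ∑ q, M ![p, a 0, q, a 1] ![p, b 0, q, b 1] := by
  rw [marginal_apply_of (t := ![0, 2]) (by decide) (g := fun a c => ![c 0, a 0, c 1, a 1])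
    (by intro a c i; fin_cases i <;> rfl) (by intro a c i; fin_cases i <;> rfl), sum_qubit_two]
  rfl

theorem marginal_zero_one_four (M : QubitOp 4) (a b : Fin 2 → Fin 2) :
    marginal ![0, 1] M a b = ∑ c : Fin 2 → Fin 2, M ![a 0, a 1, c 0, c 1] ![b 0, b 1, c 0, c 1] :=
  marginal_apply_of (t := ![2, 3]) (by decide) (g := fun a c => ![a 0, a 1, c 0, c 1])
    (by intro a c i; fin_cases i <;> rfl) (by intro a c i; fin_cases i <;> rfl) M a b

theorem marginal_two_three_four (M : QubitOp 4) (a b : Fin 2 → Fin 2) :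
    marginal ![2, 3] M a b = ∑ c : Fin 2 → Fin 2, M ![c 0, c 1, a 0, a 1] ![c 0, c 1, b 0, b 1] :=
  marginal_apply_of (t := ![0, 1]) (by decide) (g := fun a c => ![c 0, c 1, a 0, a 1])
    (by intro a c i; fin_cases i <;> rfl) (by intro a c i; fin_cases i <;> rfl) M a b

theorem marginal_id {n : ℕ} (ρ : QubitOp n) : marginal id ρ = ρ := by
  ext a b
  rw [marginal_apply_of (s := id) (t := (Fin.elim0 : Fin 0 → Fin n)) (g := fun a _ => a)]
  · simp
  · constructor
    · rintro (i | i) (j | j) h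
      · exact congrArg _ h
      · exact j.elim0
      · exact i.elim0
      · exact i.elim0
    · exact fun i => ⟨.inl i, rfl⟩
  · intros; rfl
  · exact fun _ _ i => i.elim0

theorem marginal_tensor_left (α β : QubitOp 2) :
    marginal ![0, 1] (tensor α β) = β.trace • α := by
  have h := marginal_tensor_castAdd id α β
  rw [marginal_id] at h
  rw [← h]
  congr 1
  ext i; fin_cases i <;> rfl

theorem marginal_tensor_right (α β : QubitOp 2) :
    marginal ![2, 3] (tensor α β) = α.trace • β := by
  have h := marginal_tensor_natAdd id α β
  rw [marginal_id] at h
  rw [← h]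
  congr 1
  ext i; fin_cases i <;> rfl

/-! ### Sufficiency: when the marginals determine the state -/

section Determined

variable {α β : QubitOp 2} {σ : QubitOp 4}

/-- Both σ and α ⊗ β are positive with marginal α on the first pair, so the slices of each are
supported on α, and hence so are those of the difference. -/
theorem slice_sub_supportedOn_left (hα : IsState α) (hβ : IsState β) (hσ : IsState σ)
    (hc : IsCompatible 2 σ (tensor α β)) (c c' : Fin 2 → Fin 2) :
    SupportedOn (Matrix.of fun a b : Fin 2 → Fin 2 =>
      (σ - tensor α β) ![a 0, a 1, c 0, c 1] ![b 0, b 1, c' 0, c' 1]) α := by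
  have hm : marginal ![0, 1] (tensor α β) = α := by
    rw [marginal_tensor_left, hβ.2, one_smul]
  have h1 := SupportedOn.slice_marginal (s := ![0, 1]) (t := ![2, 3]) (by decide)
    (g := fun a c => ![a 0, a 1, c 0, c 1]) (by intro a c i; fin_cases i <;> rfl)
    (by intro a c i; fin_cases i <;> rfl) hσ.1
    (.refl hσ.1.isHermitian) c c'
  have h2 := SupportedOn.slice_marginal (s := ![0, 1]) (t := ![2, 3]) (by decide)
    (g := fun a c => ![a 0, a 1, c 0, c 1]) (by intro a c i; fin_cases i <;> rfl)
    (by intro a c i; fin_cases i <;> rfl) (tensor_isState hα hβ).1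
    (.refl (tensor_isState hα hβ).1.isHermitian) c c'
  rw [hc ![0, 1] (by decide), hm] at h1
  rw [hm] at h2
  exact h1.sub h2

theorem slice_sub_supportedOn_right (hα : IsState α) (hβ : IsState β) (hσ : IsState σ)
    (hc : IsCompatible 2 σ (tensor α β)) (c c' : Fin 2 → Fin 2) :
    SupportedOn (Matrix.of fun a b : Fin 2 → Fin 2 =>
      (σ - tensor α β) ![c 0, c 1, a 0, a 1] ![c' 0, c' 1, b 0, b 1]) β := by
  have hm : marginal ![2, 3] (tensor α β) = β := by
    rw [marginal_tensor_right, hα.2, one_smul]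
  have h1 := SupportedOn.slice_marginal (s := ![2, 3]) (t := ![0, 1]) (by decide)
    (g := fun a c => ![c 0, c 1, a 0, a 1]) (by intro a c i; fin_cases i <;> rfl)
    (by intro a c i; fin_cases i <;> rfl) hσ.1
    (.refl hσ.1.isHermitian) c c'
  have h2 := SupportedOn.slice_marginal (s := ![2, 3]) (t := ![0, 1]) (by decide)
    (g := fun a c => ![c 0, c 1, a 0, a 1]) (by intro a c i; fin_cases i <;> rfl)
    (by intro a c i; fin_cases i <;> rfl) (tensor_isState hα hβ).1
    (.refl (tensor_isState hα hβ).1.isHermitian) c c'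
  rw [hc ![2, 3] (by decide), hm] at h1
  rw [hm] at h2
  exact h1.sub h2

theorem marginal_sub_eq_zero (hc : IsCompatible 2 σ (tensor α β)) {s : Fin 2 → Fin 4}
    (hs : Function.Injective s) : marginal s (σ - tensor α β) = 0 := by
  rw [marginal_sub, hc s hs, sub_self]

theorem eta_four (x : Fin 4 → Fin 2) : ![x 0, x 1, x 2, x 3] = x := by
  ext i; fin_cases i <;> rfl

theorem isUDA_of_isPure_left (hα : IsState α) (hβ : IsState β) (hp : IsPure α) :
    IsUDA 2 (tensor α β) := by
  intro σ hσ hc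
  obtain ⟨ψ, hψ, hαψ⟩ := hp
  rw [← sub_eq_zero]
  ext x y
  have h := slice_sub_supportedOn_left hα hβ hσ hc ![x 2, x 3] ![y 2, y 3]
  rw [hαψ] at h
  have h' := h.eq_trace_smul hψ
  have htr := congrFun (congrFun (marginal_sub_eq_zero hc (s := ![2, 3]) (by decide)) ![x 2, x 3])
    ![y 2, y 3]
  rw [marginal_two_three_four] at htr
  have h0 : (Matrix.of fun a b : Fin 2 → Fin 2 =>
      (σ - tensor α β) ![a 0, a 1, x 2, x 3] ![b 0, b 1, y 2, y 3]).trace = 0 := htr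
  have h1 := congrFun (congrFun h' ![x 0, x 1]) ![y 0, y 1]
  rw [← hαψ] at h1
  erw [h0, zero_smul] at h1
  simpa [eta_four] using h1

theorem isUDA_of_isPure_right (hα : IsState α) (hβ : IsState β) (hp : IsPure β) :
    IsUDA 2 (tensor α β) := by
  intro σ hσ hc
  obtain ⟨ψ, hψ, hβψ⟩ := hp
  rw [← sub_eq_zero]
  ext x y
  have h := slice_sub_supportedOn_right hα hβ hσ hc ![x 0, x 1] ![y 0, y 1]
  rw [hβψ] at h
  have h' := h.eq_trace_smul hψ
  have htr := congrFun (congrFun (marginal_sub_eq_zero hc (s := ![0, 1]) (by decide)) ![x 0, x 1])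
    ![y 0, y 1]
  rw [marginal_zero_one_four] at htr
  have h0 : (Matrix.of fun a b : Fin 2 → Fin 2 =>
      (σ - tensor α β) ![x 0, x 1, a 0, a 1] ![y 0, y 1, b 0, b 1]).trace = 0 := htr
  have h1 := congrFun (congrFun h' ![x 2, x 3]) ![y 2, y 3]
  rw [← hβψ] at h1
  erw [h0, zero_smul] at h1
  simpa [eta_four] using h1

/-- The slices need not be Hermitian, which is why `NoCorrelation` quantifies over all operators.
The hypothesis on α kills the traces over A₄ and over A₃; these are precisely the marginals of the
slices on A₃A₄ to which the hypothesis on β applies. -/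
theorem isUDA_of_noCorrelation (hα : IsState α) (hβ : IsState β) (hA : NoCorrelation α)
    (hB : NoCorrelation β) : IsUDA 2 (tensor α β) := by
  intro σ hσ hc
  rw [← sub_eq_zero]
  have hsA := slice_sub_supportedOn_left hα hβ hσ hc
  have hsB := slice_sub_supportedOn_right hα hβ hσ hc
  have hm := fun (s : Fin 2 → Fin 4) hs a b =>
    congrFun (congrFun (marginal_sub_eq_zero hc (s := s) hs) a) b
  generalize σ - tensor α β = M at hsA hsB hm
  have h3 : ∀ (a b : Fin 2 → Fin 2) (c c' : Fin 2),
      ∑ q, M ![a 0, a 1, c, q] ![b 0, b 1, c', q] = 0 := by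
    intro a b c c'
    have h := hA (∑ q, Matrix.of fun a b : Fin 2 → Fin 2 =>
      M ![a 0, a 1, c, q] ![b 0, b 1, c', q])
      ⟨.sum _ fun q => hsA ![c, q] ![c', q], ?_, ?_⟩
    · have := congrFun (congrFun h a) b
      simpa only [Matrix.sum_apply, Matrix.of_apply, Matrix.zero_apply] using this
    · ext u v
      have := hm ![0, 2] (by decide) ![u 0, c] ![v 0, c']
      rw [marginal_zero_two_four] at this
      simp only [marginal_zero_two, Matrix.sum_apply]
      exact this
    · ext u v
      have := hm ![1, 2] (by decide) ![u 0, c] ![v 0, c']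
      rw [marginal_one_two_four] at this
      simp only [marginal_one_two, Matrix.sum_apply]
      exact this
  have h2 : ∀ (a b : Fin 2 → Fin 2) (c c' : Fin 2),
      ∑ q, M ![a 0, a 1, q, c] ![b 0, b 1, q, c'] = 0 := by
    intro a b c c'
    have h := hA (∑ q, Matrix.of fun a b : Fin 2 → Fin 2 =>
      M ![a 0, a 1, q, c] ![b 0, b 1, q, c'])
      ⟨.sum _ fun q => hsA ![q, c] ![q, c'], ?_, ?_⟩
    · have := congrFun (congrFun h a) b
      simpa only [Matrix.sum_apply, Matrix.of_apply, Matrix.zero_apply] using this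
    · ext u v
      have := hm ![0, 3] (by decide) ![u 0, c] ![v 0, c']
      rw [marginal_zero_three_four] at this
      simp only [marginal_zero_two, Matrix.sum_apply]
      exact this
    · ext u v
      have := hm ![1, 3] (by decide) ![u 0, c] ![v 0, c']
      rw [marginal_one_three_four] at this
      simp only [marginal_one_two, Matrix.sum_apply]
      exact this
  ext x y
  have h := hB _ ⟨hsB ![x 0, x 1] ![y 0, y 1], ?_, ?_⟩
  · have := congrFun (congrFun h ![x 2, x 3]) ![y 2, y 3]
    simpa [eta_four] using this
  · ext u v
    rw [marginal_zero_two]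
    exact h3 ![x 0, x 1] ![y 0, y 1] (u 0) (v 0)
  · ext u v
    rw [marginal_one_two]
    exact h2 ![x 0, x 1] ![y 0, y 1] (u 0) (v 0)

end Determined

/-! ### Necessity: perturbing along a product operator -/

theorem injective_pair_cases : ∀ s : Fin 2 → Fin 4, Function.Injective s →
    (∃ t : Fin 2 → Fin 2, s = Fin.castAdd 2 ∘ t) ∨ (∃ t : Fin 2 → Fin 2, s = Fin.natAdd 2 ∘ t) ∨
      ∃ i j : Fin 2, s = ![Fin.castAdd 2 i, Fin.natAdd 2 j] ∨
        s = ![Fin.natAdd 2 j, Fin.castAdd 2 i] := by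
  decide

theorem marginal_tensor_pair (X Z : QubitOp 2) (i j : Fin 2) :
    marginal ![Fin.castAdd 2 i, Fin.natAdd 2 j] (tensor X Z) =
      tensor (marginal ![i] X) (marginal ![j] Z) := by
  rw [← marginal_tensor_append]
  congr 1
  ext k
  fin_cases k <;> rfl

theorem marginal_swap {n : ℕ} (i j : Fin n) (ρ : QubitOp n) :
    marginal ![j, i] ρ = (marginal ![i, j] ρ).submatrix (· ∘ Equiv.swap 0 1)
      (· ∘ Equiv.swap 0 1) := by
  have h := marginal_comp_perm ![i, j] (Equiv.swap 0 1) ρ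
  rw [Equiv.symm_swap] at h
  rw [← h]
  congr 1
  ext k
  fin_cases k <;> rfl

theorem marginal_tensor_eq_zero {X Z : QubitOp 2} (hX : X.trace = 0) (hZ : Z.trace = 0)
    (h : ∀ i j : Fin 2, marginal ![i] X = 0 ∨ marginal ![j] Z = 0) {s : Fin 2 → Fin 4}
    (hs : Function.Injective s) : marginal s (tensor X Z) = 0 := by
  have hij : ∀ i j : Fin 2, marginal ![Fin.castAdd 2 i, Fin.natAdd 2 j] (tensor X Z) = 0 := by
    intro i j
    rw [marginal_tensor_pair]
    ext a b
    rcases h i j with h | h <;> simp [h, tensor]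
  obtain ⟨t, rfl⟩ | ⟨t, rfl⟩ | ⟨i, j, rfl | rfl⟩ := injective_pair_cases s hs
  · rw [marginal_tensor_castAdd, hZ, zero_smul]
  · rw [marginal_tensor_natAdd, hX, zero_smul]
  · exact hij i j
  · rw [marginal_swap, hij]
    rfl

/-- Tracelessness kills the marginals of X ⊗ Z inside either pair, and the last hypothesis kills
those across the pairs. -/
theorem not_isUDA_of_perturbation {α β X Z : QubitOp 2} (hα : IsState α) (hβ : IsState β)
    (hXH : X.IsHermitian) (hZH : Z.IsHermitian) (hXs : SupportedOn X α) (hZs : SupportedOn Z β)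
    (hX : X.trace = 0) (hZ : Z.trace = 0) (hX0 : X ≠ 0) (hZ0 : Z ≠ 0)
    (h : ∀ i j : Fin 2, marginal ![i] X = 0 ∨ marginal ![j] Z = 0) :
    ¬ IsUDA 2 (tensor α β) := by
  intro hU
  obtain ⟨ε, hε, hεX⟩ := exists_perturb hα.1 hXH hXs
  obtain ⟨δ, hδ, hδZ⟩ := exists_perturb hβ.1 hZH hZs
  -- The average of (α + εX) ⊗ (β + δZ) and (α - εX) ⊗ (β - δZ): the terms linear in X or Z cancel.
  have hpos : (tensor α β + ((ε * δ : ℝ) : ℂ) • tensor X Z).PosSemidef := by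
    have h1 := tensor_posSemidef (hεX ε (abs_of_pos hε).le) (hδZ δ (abs_of_pos hδ).le)
    have h2 := tensor_posSemidef (hεX (-ε) (by rw [abs_neg, abs_of_pos hε]))
      (hδZ (-δ) (by rw [abs_neg, abs_of_pos hδ]))
    have h3 := (h1.add h2).smul (show (0 : ℂ) ≤ 1 / 2 by
      rw [Complex.nonneg_iff]; norm_num)
    convert h3 using 1
    ext x y
    simp only [tensor, Matrix.add_apply, Matrix.smul_apply, Matrix.of_apply, smul_eq_mul]
    push_cast
    ring
  have hst : IsState (tensor α β + ((ε * δ : ℝ) : ℂ) • tensor X Z) := by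
    refine ⟨hpos, ?_⟩
    rw [Matrix.trace_add, Matrix.trace_smul, tensor_trace, tensor_trace, hα.2, hβ.2, hX]
    simp
  have heq := hU _ hst fun s hs => by
    rw [marginal_add, marginal_smul, marginal_tensor_eq_zero hX hZ h hs, smul_zero, add_zero]
  rw [add_eq_left] at heq
  refine tensor_ne_zero hX0 hZ0 ((smul_eq_zero.1 heq).resolve_left ?_)
  exact_mod_cast (mul_pos hε hδ).ne'

theorem trace_marginal_zero (X : QubitOp 2) : (marginal ![0] X).trace = X.trace := by
  simp only [Matrix.trace, Matrix.diag, sum_qubit_one, sum_qubit_two, marginal_zero_two]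
  rfl

theorem IsCorrelationOn.trace_eq_zero {X α : QubitOp 2} (h : IsCorrelationOn X α) :
    X.trace = 0 := by
  rw [← trace_marginal_zero, h.2.1, Matrix.trace_zero]

theorem IsCorrelationOn.marginal_eq_zero {X α : QubitOp 2} (h : IsCorrelationOn X α) (i : Fin 2) :
    marginal ![i] X = 0 := by
  fin_cases i
  · exact h.2.1
  · exact h.2.2

theorem IsUDA.correlation_eq_zero_left {α β : QubitOp 2} (hα : IsState α) (hβ : IsState β)
    (h : IsUDA 2 (tensor α β)) (hp : ¬ IsPure β) {X : QubitOp 2} (hX : X.IsHermitian)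
    (hc : IsCorrelationOn X α) : X = 0 := by
  by_contra hX0
  obtain ⟨Z, hZ, hZs, hZt, hZ0⟩ := exists_traceless_supportedOn hβ hp
  exact not_isUDA_of_perturbation hα hβ hX hZ hc.1 hZs hc.trace_eq_zero hZt hX0 hZ0
    (fun i _ => .inl (hc.marginal_eq_zero i)) h

theorem IsUDA.correlation_eq_zero_right {α β : QubitOp 2} (hα : IsState α) (hβ : IsState β)
    (h : IsUDA 2 (tensor α β)) (hp : ¬ IsPure α) {Z : QubitOp 2} (hZ : Z.IsHermitian)
    (hc : IsCorrelationOn Z β) : Z = 0 := by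
  by_contra hZ0
  obtain ⟨X, hX, hXs, hXt, hX0⟩ := exists_traceless_supportedOn hα hp
  exact not_isUDA_of_perturbation hα hβ hX hZ hXs hc.1 hXt hc.trace_eq_zero hX0 hZ0
    (fun _ j => .inr (hc.marginal_eq_zero j)) h

/-! ### Two-qubit states with a pure marginal -/

theorem forall_qubit_two {p : (Fin 2 → Fin 2) → Prop} :
    (∀ x, p x) ↔ p ![0, 0] ∧ p ![0, 1] ∧ p ![1, 0] ∧ p ![1, 1] := by
  refine ⟨fun h => ⟨h _, h _, h _, h _⟩, fun h x => ?_⟩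
  have hx : x = ![x 0, x 1] := by ext i; fin_cases i <;> rfl
  rw [hx]
  generalize x 0 = a
  generalize x 1 = b
  fin_cases a <;> fin_cases b
  exacts [h.1, h.2.1, h.2.2.1, h.2.2.2]

theorem sum_qubit_four (f : (Fin 2 → Fin 2) → ℂ) :
    ∑ x, f x = f ![0, 0] + f ![0, 1] + f ![1, 0] + f ![1, 1] := by
  simp only [sum_qubit_two, Fin.sum_univ_two]
  ring

theorem mulVec_apply_two (A : QubitOp 2) (v : (Fin 2 → Fin 2) → ℂ) (x : Fin 2 → Fin 2) :
    (A *ᵥ v) x = A x ![0, 0] * v ![0, 0] + A x ![0, 1] * v ![0, 1] + A x ![1, 0] * v ![1, 0] +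
      A x ![1, 1] * v ![1, 1] :=
  sum_qubit_four fun y => A x y * v y

section PureMarginal

theorem bijective_pair {i j : Fin 2} (hij : i ≠ j) :
    Function.Bijective (Sum.elim ![i] ![j]) := by
  revert i j
  decide

/-- The slices of X on qubit i are supported on a pure state, hence are multiples of it; their
traces are the entries of the marginal of X on the other qubit. -/
theorem SupportedOn.eq_mul_of_isPure_marginal {α X : QubitOp 2} (hα : α.PosSemidef)
    (hX : SupportedOn X α) {i j : Fin 2} (hij : i ≠ j) (hp : IsPure (marginal ![i] α))
    (x y : Fin 2 → Fin 2) :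
    X x y = marginal ![i] α (x ∘ ![i]) (y ∘ ![i]) * marginal ![j] X (x ∘ ![j]) (y ∘ ![j]) := by
  set g : (Fin 1 → Fin 2) → (Fin 1 → Fin 2) → Fin 2 → Fin 2 :=
    fun a c k => if k = i then a 0 else c 0 with hg
  have hgi : ∀ a c k, g a c (![i] k) = a k := by
    intro a c k; fin_cases k; simp [hg]
  have hgj : ∀ a c k, g a c (![j] k) = c k := by
    intro a c k; fin_cases k; simp [hg, hij.symm]
  have hx : ∀ x : Fin 2 → Fin 2, g (x ∘ ![i]) (x ∘ ![j]) = x := by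
    intro x
    ext1 k
    by_cases hk : k = i
    · simp [hg, hk]
    · have : k = j := by
        clear * - hij hk
        revert i j k
        decide
      simp [hg, this, hij.symm]
  have hs := hX.slice_marginal (bijective_pair hij) hgi hgj hα (x ∘ ![j]) (y ∘ ![j])
  obtain ⟨ψ, hψ, hαψ⟩ := hp
  rw [hαψ] at hs
  have h1 := congrFun (congrFun (hs.eq_trace_smul hψ) (x ∘ ![i])) (y ∘ ![i])
  have h2 : (Matrix.of fun a b => X (g a (x ∘ ![j])) (g b (y ∘ ![j]))).trace =
      marginal ![j] X (x ∘ ![j]) (y ∘ ![j]) := by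
    have hb : Function.Bijective (Sum.elim ![j] ![i]) := bijective_pair hij.symm
    rw [marginal_apply_of hb (g := fun a c => g c a) (fun a c k => hgj c a k)
      (fun a c k => hgi c a k)]
    rfl
  rw [h2, ← hαψ] at h1
  rw [Matrix.of_apply, hx, hx, Matrix.smul_apply, smul_eq_mul] at h1
  rw [h1, mul_comm]

theorem eq_marginal_mul_marginal {α : QubitOp 2} (hα : α.PosSemidef) {i j : Fin 2} (hij : i ≠ j)
    (hp : IsPure (marginal ![i] α)) (x y : Fin 2 → Fin 2) :
    α x y = marginal ![i] α (x ∘ ![i]) (y ∘ ![i]) * marginal ![j] α (x ∘ ![j]) (y ∘ ![j]) :=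
  (SupportedOn.refl hα.isHermitian).eq_mul_of_isPure_marginal hα hij hp x y

theorem noCorrelation_of_isPure_marginal {α : QubitOp 2} (hα : α.PosSemidef) {i : Fin 2}
    (hp : IsPure (marginal ![i] α)) : NoCorrelation α := by
  intro X hX
  obtain ⟨j, hij⟩ : ∃ j, i ≠ j := (by decide : ∀ i : Fin 2, ∃ j, i ≠ j) i
  ext x y
  rw [hX.1.eq_mul_of_isPure_marginal hα hij hp, hX.marginal_eq_zero j]
  simp

end PureMarginal

/-! ### Classification of two-qubit states without correlations -/

theorem finrank_ker_add_rank (α : QubitOp 2) :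
    Module.finrank ℂ (LinearMap.ker α.mulVecLin) + α.rank = 4 := by
  have h := LinearMap.finrank_range_add_finrank_ker α.mulVecLin
  rw [Module.finrank_fintype_fun_eq_card] at h
  have h4 : Fintype.card (Fin 2 → Fin 2) = 4 := by simp
  rw [h4] at h
  rw [Matrix.rank]
  omega

theorem marginal_zero_eq_zero_iff {X : QubitOp 2} :
    marginal ![0] X = 0 ↔ ∀ a b, X ![a, 0] ![b, 0] + X ![a, 1] ![b, 1] = 0 := by
  constructor
  · intro h a b
    have := congrFun (congrFun h ![a]) ![b]
    rw [marginal_zero_two, Fin.sum_univ_two] at this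
    exact this
  · intro h
    ext a b
    rw [marginal_zero_two, Fin.sum_univ_two]
    exact h _ _

theorem marginal_one_eq_zero_iff {X : QubitOp 2} :
    marginal ![1] X = 0 ↔ ∀ a b, X ![0, a] ![0, b] + X ![1, a] ![1, b] = 0 := by
  constructor
  · intro h a b
    have := congrFun (congrFun h ![a]) ![b]
    rw [marginal_one_two, Fin.sum_univ_two] at this
    exact this
  · intro h
    ext a b
    rw [marginal_one_two, Fin.sum_univ_two]
    exact h _ _

/-- A correlation X has zero row and column at |11⟩, so the marginal equations leave only its two
entries between |01⟩ and |10⟩. A second kernel vector of α, with a nonzero component at |01⟩ or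
|10⟩, removes these through X and its adjoint. -/
theorem noCorrelation_of_corner {α : QubitOp 2} (hr : α.rank ≤ 2) (h11 : ∀ x, α x ![1, 1] = 0)
    (h00 : α ![0, 0] ![0, 0] ≠ 0) : NoCorrelation α := by
  obtain ⟨n, hn, hn'⟩ : ∃ n, α *ᵥ n = 0 ∧ (n ![0, 1] ≠ 0 ∨ n ![1, 0] ≠ 0) := by
    by_contra! hc
    -- Otherwise the row of α at |00⟩, with nonzero diagonal entry, confines the kernel to the line
    -- of |11⟩, contradicting rank at most 2.
    have hle : LinearMap.ker α.mulVecLin ≤ ℂ ∙ (Pi.single ![1, 1] 1 : (Fin 2 → Fin 2) → ℂ) := by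
      intro n hn
      have hn : α *ᵥ n = 0 := by simpa using hn
      obtain ⟨h1, h2⟩ := hc n hn
      have h3 : n ![0, 0] = 0 := by
        have := congrFun hn ![0, 0]
        rw [mulVec_apply_two, h1, h2, h11] at this
        simpa [h00] using this
      rw [Submodule.mem_span_singleton]
      refine ⟨n ![1, 1], funext (forall_qubit_two.2 ?_)⟩
      simp [h1, h2, h3]
    have h1 := Submodule.finrank_mono hle
    have h2 := finrank_span_singleton (K := ℂ)
      (v := (Pi.single ![1, 1] 1 : (Fin 2 → Fin 2) → ℂ)) (by simp)
    have h3 := finrank_ker_add_rank α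
    omega
  intro X hX
  have hk : α *ᵥ Pi.single ![1, 1] 1 = 0 := by
    ext x; simp [h11]
  have c1 : ∀ x, X x ![1, 1] = 0 := by
    intro x
    simpa using congrFun (hX.1.1 _ hk) x
  have c2 : ∀ x, X ![1, 1] x = 0 := by
    intro x
    simpa using congrFun (hX.1.2 _ hk) x
  have m0 := marginal_zero_eq_zero_iff.1 hX.2.1
  have m1 := marginal_one_eq_zero_iff.1 hX.2.2
  have e1010 : X ![1, 0] ![1, 0] = 0 := by simpa [c1] using m0 1 1
  have e0101 : X ![0, 1] ![0, 1] = 0 := by simpa [c1] using m1 1 1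
  have e0000 : X ![0, 0] ![0, 0] = 0 := by simpa [e0101] using m0 0 0
  have e0010 : X ![0, 0] ![1, 0] = 0 := by simpa [c1] using m0 0 1
  have e1000 : X ![1, 0] ![0, 0] = 0 := by simpa [c2] using m0 1 0
  have e0001 : X ![0, 0] ![0, 1] = 0 := by simpa [c1] using m1 0 1
  have e0100 : X ![0, 1] ![0, 0] = 0 := by simpa [c2] using m1 1 0
  have r1 := congrFun (hX.1.1 n hn) ![0, 1]
  have r2 := congrFun (hX.1.1 n hn) ![1, 0]
  have r3 := congrFun (hX.1.2 n hn) ![0, 1]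
  have r4 := congrFun (hX.1.2 n hn) ![1, 0]
  simp only [mulVec_apply_two, Matrix.conjTranspose_apply, c1, c2, e0100, e0101, e1000, e1010,
    e0001, e0010, star_zero, zero_mul, zero_add, add_zero, Pi.zero_apply, mul_eq_zero,
    star_eq_zero] at r1 r2 r3 r4
  have e0110 : X ![0, 1] ![1, 0] = 0 := by tauto
  have e1001 : X ![1, 0] ![0, 1] = 0 := by tauto
  ext x y
  revert x y
  simp only [forall_qubit_two, Matrix.zero_apply, *, and_self]

noncomputable section

/-- The operator on two qubits with the given matrix in the basis `|00⟩, |01⟩, |10⟩, |11⟩`. -/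
def ofFour (A : Matrix (Fin 4) (Fin 4) ℂ) : QubitOp 2 :=
  A.submatrix (fun i => finProdFinEquiv (i 0, i 1)) (fun i => finProdFinEquiv (i 0, i 1))

/-- The Hermitian two-qubit operators with vanishing one-qubit marginals, parametrized linearly. -/
def correlationMatrix : (ℝ × ℂ × ℂ × ℂ × ℂ) →ₗ[ℝ] QubitOp 2 where
  toFun p := ofFour !![(p.1 : ℂ), p.2.1, p.2.2.1, p.2.2.2.1;
    star p.2.1, -(p.1 : ℂ), p.2.2.2.2, -p.2.2.1;
    star p.2.2.1, star p.2.2.2.2, -(p.1 : ℂ), -p.2.1;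
    star p.2.2.2.1, -star p.2.2.1, -star p.2.1, (p.1 : ℂ)]
  map_add' p q := by
    ext i j
    simp only [ofFour, Matrix.submatrix_apply, Matrix.add_apply]
    generalize (finProdFinEquiv (i 0, i 1) : Fin 4) = k
    generalize (finProdFinEquiv (j 0, j 1) : Fin 4) = l
    fin_cases k <;> fin_cases l <;> simp <;> ring
  map_smul' c p := by
    ext i j
    simp only [ofFour, Matrix.submatrix_apply, Matrix.smul_apply]
    generalize (finProdFinEquiv (i 0, i 1) : Fin 4) = k
    generalize (finProdFinEquiv (j 0, j 1) : Fin 4) = l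
    fin_cases k <;> fin_cases l <;> simp

end

theorem correlationMatrix_isHermitian (p : ℝ × ℂ × ℂ × ℂ × ℂ) :
    (correlationMatrix p).IsHermitian := by
  refine Matrix.IsHermitian.submatrix ?_ _
  ext k l
  fin_cases k <;> fin_cases l <;> simp

theorem marginal_zero_correlationMatrix (p : ℝ × ℂ × ℂ × ℂ × ℂ) :
    marginal ![0] (correlationMatrix p) = 0 := by
  refine marginal_zero_eq_zero_iff.2 fun a b => ?_
  fin_cases a <;> fin_cases b
  · exact add_neg_cancel (p.1 : ℂ)
  · exact add_neg_cancel p.2.2.1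
  · exact add_neg_cancel (star p.2.2.1)
  · exact neg_add_cancel (p.1 : ℂ)

theorem marginal_one_correlationMatrix (p : ℝ × ℂ × ℂ × ℂ × ℂ) :
    marginal ![1] (correlationMatrix p) = 0 := by
  refine marginal_one_eq_zero_iff.2 fun a b => ?_
  fin_cases a <;> fin_cases b
  · exact add_neg_cancel (p.1 : ℂ)
  · exact add_neg_cancel p.2.1
  · exact add_neg_cancel (star p.2.1)
  · exact neg_add_cancel (p.1 : ℂ)

theorem correlationMatrix_ne_zero {p : ℝ × ℂ × ℂ × ℂ × ℂ} (hp : p ≠ 0) :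
    correlationMatrix p ≠ 0 := by
  intro h
  have e : ∀ x y, correlationMatrix p x y = 0 := fun x y => by rw [h]; rfl
  have h1 : (p.1 : ℂ) = 0 := e ![0, 0] ![0, 0]
  have h2 : p.2.1 = 0 := e ![0, 0] ![0, 1]
  have h3 : p.2.2.1 = 0 := e ![0, 0] ![1, 0]
  have h4 : p.2.2.2.1 = 0 := e ![0, 0] ![1, 1]
  have h5 : p.2.2.2.2 = 0 := e ![0, 1] ![1, 0]
  exact hp (Prod.ext (by exact_mod_cast h1) (Prod.ext h2 (Prod.ext h3 (Prod.ext h4 h5))))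

/-- On a subspace of codimension at most one there is a Hermitian correlation operator. -/
theorem exists_correlation_of_two_lt_rank {α : QubitOp 2} (hr : 2 < α.rank) :
    ∃ X : QubitOp 2, X.IsHermitian ∧ IsCorrelationOn X α ∧ X ≠ 0 := by
  have hk : Module.finrank ℂ (LinearMap.ker α.mulVecLin) ≤ 1 := by
    have := finrank_ker_add_rank α
    omega
  obtain ⟨v, hv⟩ := finrank_le_one_iff.1 hk
  set Φ : (ℝ × ℂ × ℂ × ℂ × ℂ) →ₗ[ℝ] (Fin 2 → Fin 2) → ℂ :=
    { toFun := fun p => correlationMatrix p *ᵥ (v : (Fin 2 → Fin 2) → ℂ)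
      map_add' := fun p q => by rw [map_add, Matrix.add_mulVec]
      map_smul' := fun c p => by rw [map_smul, Matrix.smul_mulVec, RingHom.id_apply] } with hΦ
  have hker : LinearMap.ker Φ ≠ ⊥ := by
    -- The real dimensions are 1 + 4·2 = 9 for the source and 4·2 = 8 for the target.
    refine LinearMap.ker_ne_bot_of_finrank_lt ?_
    have h4 : Fintype.card (Fin 2 → Fin 2) = 4 := by simp
    simp only [Module.finrank_prod, Module.finrank_self, Complex.finrank_real_complex,
      Module.finrank_pi_fintype, Finset.sum_const, Finset.card_univ, h4]
    norm_num
  obtain ⟨p, hp, hp0⟩ := Submodule.exists_mem_ne_zero_of_ne_bot hker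
  have hpv : correlationMatrix p *ᵥ (v : (Fin 2 → Fin 2) → ℂ) = 0 := hp
  refine ⟨correlationMatrix p, correlationMatrix_isHermitian p, ⟨?_,
    marginal_zero_correlationMatrix p, marginal_one_correlationMatrix p⟩,
    correlationMatrix_ne_zero hp0⟩
  refine .of_isHermitian (correlationMatrix_isHermitian p) fun w hw => ?_
  obtain ⟨c, hc⟩ := hv ⟨w, by simpa using hw⟩
  have hc' : w = c • (v : (Fin 2 → Fin 2) → ℂ) := (congrArg Subtype.val hc).symm
  rw [hc', Matrix.mulVec_smul, hpv, smul_zero]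

/-- Read v as a 2 × 2 matrix of amplitudes: a nonzero singular one has rank one, and its
factorization gives the product vector. -/
theorem exists_product_of_det_eq_zero {v : (Fin 2 → Fin 2) → ℂ} (hv : v ≠ 0)
    (h : v ![0, 0] * v ![1, 1] = v ![0, 1] * v ![1, 0]) :
    ∃ a b : Fin 2 → ℂ, a ≠ 0 ∧ b ≠ 0 ∧ ∀ x, v x = a (x 0) * b (x 1) := by
  have hne : ∀ (c d : ℂ), c ≠ 0 ∨ d ≠ 0 → (![c, d] : Fin 2 → ℂ) ≠ 0 := by
    intro c d hcd h0
    have h1 : c = 0 := congrFun h0 0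
    have h2 : d = 0 := congrFun h0 1
    tauto
  by_cases h00 : v ![0, 0] = 0
  · by_cases h01 : v ![0, 1] = 0
    · refine ⟨![0, 1], ![v ![1, 0], v ![1, 1]], hne _ _ (.inr one_ne_zero), hne _ _ ?_,
        forall_qubit_two.2 ?_⟩
      · by_contra! hc
        exact hv (funext (forall_qubit_two.2 ⟨h00, h01, hc.1, hc.2⟩))
      · simp [h00, h01]
    · have h10 : v ![1, 0] = 0 := by simpa [h00, h01] using h
      refine ⟨![1, v ![1, 1] / v ![0, 1]], ![0, v ![0, 1]], hne _ _ (.inl one_ne_zero),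
        hne _ _ (.inr h01), forall_qubit_two.2 ?_⟩
      simp [h00, h10, h01]
  · refine ⟨![1, v ![1, 0] / v ![0, 0]], ![v ![0, 0], v ![0, 1]], hne _ _ (.inl one_ne_zero),
      hne _ _ (.inl h00), forall_qubit_two.2 ?_⟩
    have : v ![1, 1] = v ![1, 0] / v ![0, 0] * v ![0, 1] := by
      field_simp
      linear_combination h
    simp [h00, this]

/-- On u + t w the determinant of the amplitudes is a polynomial in t with leading coefficient det
w. Either w is already a product vector, or this quadratic has a complex root. -/
theorem exists_product_mem {S : Submodule ℂ ((Fin 2 → Fin 2) → ℂ)}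
    (hS : Module.finrank ℂ S = 2) :
    ∃ a b : Fin 2 → ℂ, a ≠ 0 ∧ b ≠ 0 ∧ (fun x => a (x 0) * b (x 1)) ∈ S := by
  suffices h : ∃ v ∈ S, v ≠ 0 ∧ v ![0, 0] * v ![1, 1] = v ![0, 1] * v ![1, 0] by
    obtain ⟨v, hvS, hv, hd⟩ := h
    obtain ⟨a, b, ha, hb, hab⟩ := exists_product_of_det_eq_zero hv hd
    exact ⟨a, b, ha, hb, by rwa [← (funext hab : v = _)]⟩
  set B := Module.finBasisOfFinrankEq ℂ S hS
  set u := ((B 0 : S) : (Fin 2 → Fin 2) → ℂ)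
  set w := ((B 1 : S) : (Fin 2 → Fin 2) → ℂ)
  have hli : ∀ s t : ℂ, s • B 0 + t • B 1 = 0 → s = 0 ∧ t = 0 := by
    have h : LinearIndependent ℂ ![B 0, B 1] := by
      convert B.linearIndependent using 1
      ext1 i
      fin_cases i <;> rfl
    exact LinearIndependent.pair_iff.1 h
  by_cases hw : w ![0, 0] * w ![1, 1] = w ![0, 1] * w ![1, 0]
  · refine ⟨w, (B 1).2, fun h0 => ?_, hw⟩
    have h1 : B 1 = 0 := Subtype.ext h0
    have := (hli 0 1 (by rw [h1]; simp)).2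
    exact one_ne_zero this
  · obtain ⟨t, ht⟩ := exists_quadratic_eq_zero (K := ℂ)
      (a := w ![0, 0] * w ![1, 1] - w ![0, 1] * w ![1, 0])
      (b := u ![0, 0] * w ![1, 1] + w ![0, 0] * u ![1, 1] - u ![0, 1] * w ![1, 0]
        - w ![0, 1] * u ![1, 0])
      (c := u ![0, 0] * u ![1, 1] - u ![0, 1] * u ![1, 0]) (sub_ne_zero.2 hw)
      (IsAlgClosed.exists_eq_mul_self _)
    refine ⟨u + t • w, S.add_mem (B 0).2 (S.smul_mem t (B 1).2), fun h0 => ?_, ?_⟩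
    · have h1 : (1 : ℂ) • B 0 + t • B 1 = 0 := Subtype.ext (by simpa using h0)
      exact one_ne_zero (hli 1 t h1).1
    · simp only [Pi.add_apply, Pi.smul_apply, smul_eq_mul]
      linear_combination ht

/-- The adjoint of U sends |1⟩ to a multiple of a; this is what rotates a product kernel vector to
|11⟩. -/
theorem exists_unitary_row {a : Fin 2 → ℂ} (ha : a ≠ 0) :
    ∃ U ∈ Matrix.unitaryGroup (Fin 2) ℂ, ∃ c : ℂ, ∀ k, star (U 1 k) = c * a k := by
  set N : ℝ := ‖a 0‖ ^ 2 + ‖a 1‖ ^ 2 with hN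
  have hN0 : 0 < N := by
    have : a 0 ≠ 0 ∨ a 1 ≠ 0 := by
      by_contra! hc
      exact ha (by ext i; fin_cases i; exacts [hc.1, hc.2])
    rcases this with h | h
    · have := norm_pos_iff.2 h; positivity
    · have := norm_pos_iff.2 h; positivity
  set r : ℝ := (Real.sqrt N)⁻¹ with hr
  have hr2 : (r : ℂ) * r * (a 0 * star (a 0) + a 1 * star (a 1)) = 1 := by
    have h1 : a 0 * star (a 0) + a 1 * star (a 1) = (N : ℂ) := by
      rw [hN]; push_cast
      rw [← Complex.mul_conj', ← Complex.mul_conj']; rfl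
    have h2 : r * r * N = 1 := by
      rw [hr, ← mul_inv, Real.mul_self_sqrt hN0.le, inv_mul_cancel₀ hN0.ne']
    rw [h1]; exact_mod_cast h2
  have hrs : star (r : ℂ) = r := Complex.conj_ofReal r
  refine ⟨!![r * a 1, -(r * a 0); r * star (a 0), r * star (a 1)], ?_, r, fun k => ?_⟩
  · rw [Matrix.mem_unitaryGroup_iff]
    ext i j
    fin_cases i <;> fin_cases j <;>
      simp only [Matrix.star_eq_conjTranspose, Matrix.mul_apply, Matrix.conjTranspose_apply,
        Fin.sum_univ_two, Matrix.of_apply, Matrix.cons_val', Matrix.cons_val_zero,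
        Matrix.cons_val_one, Matrix.cons_val_fin_one, star_mul', hrs, star_star, star_neg,
        Fin.zero_eta, Fin.mk_one, Matrix.one_apply_eq]
    · linear_combination hr2
    · rw [Matrix.one_apply_ne (by decide)]; ring
    · rw [Matrix.one_apply_ne (by decide)]; ring
    · linear_combination hr2
  · fin_cases k <;> simp [hrs]

theorem eq_blockZero {α : QubitOp 2} (hα : α.IsHermitian) (h : ∀ x, α x ![1, 1] = 0) :
    α = blockZero (α ![0, 0] ![0, 0]).re (α ![0, 1] ![0, 1]).re (α ![1, 0] ![1, 0]).re
      (α ![0, 1] ![1, 0]) (α ![0, 0] ![0, 1]) (α ![0, 0] ![1, 0]) := by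
  have hd : ∀ x, α x x = ((α x x).re : ℂ) := fun x => (hα.coe_re_apply_self x).symm
  have h' : ∀ x, α ![1, 1] x = 0 := fun x => by rw [← hα.apply, h, star_zero]
  ext x y
  revert x y
  simp only [forall_qubit_two]
  exact ⟨⟨hd _, rfl, rfl, h _⟩, ⟨(hα.apply _ _).symm, hd _, rfl, h _⟩,
    ⟨(hα.apply _ _).symm, (hα.apply _ _).symm, hd _, h _⟩, ⟨h' _, h' _, h' _, h' _⟩⟩

theorem blockZero_corner (q₁ q₂ q₃ : ℝ) (x y z : ℂ) (i : Fin 2 → Fin 2) :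
    blockZero q₁ q₂ q₃ x y z i ![1, 1] = 0 := by
  revert i
  rw [forall_qubit_two]
  exact ⟨rfl, rfl, rfl, rfl⟩

theorem isPure_of_eq_vecMulVec {n : ℕ} {α : QubitOp n} (hα : α.trace = 1)
    {ψ : (Fin n → Fin 2) → ℂ} (h : α = Matrix.vecMulVec ψ (star ψ)) : IsPure α := by
  refine ⟨ψ, ?_, h⟩
  rw [h, Matrix.trace_vecMulVec] at hα
  have : ((∑ x, ‖ψ x‖ ^ 2 : ℝ) : ℂ) = 1 := by
    rw [← hα]
    simp [dotProduct, Complex.mul_conj']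
  exact_mod_cast this

theorem isPure_of_isPure_marginals {α : QubitOp 2} (hα : IsState α) {i j : Fin 2} (hij : i ≠ j)
    (hi : IsPure (marginal ![i] α)) (hj : IsPure (marginal ![j] α)) : IsPure α := by
  have h := eq_marginal_mul_marginal hα.1 hij hi
  obtain ⟨ψ, -, hψ⟩ := hi
  obtain ⟨φ, -, hφ⟩ := hj
  refine isPure_of_eq_vecMulVec hα.2 (ψ := fun x => ψ (x ∘ ![i]) * φ (x ∘ ![j])) ?_
  ext x y
  rw [h x y, hψ, hφ]
  simp only [Matrix.vecMulVec_apply, Pi.star_apply, star_mul']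
  ring

theorem Matrix.PosSemidef.apply_eq_zero_of_diag {P : Type*} [Fintype P] [DecidableEq P]
    {α : Matrix P P ℂ} (hα : α.PosSemidef) {i : P} (h : α i i = 0) (j : P) : α j i = 0 := by
  have h1 : star (Pi.single i 1 : P → ℂ) ⬝ᵥ (α *ᵥ Pi.single i 1) = 0 := by
    rw [Pi.star_single, star_one, single_dotProduct, mulVec_single_one]
    simpa using h
  simpa using congrFun ((hα.dotProduct_mulVec_zero_iff _).1 h1) j

theorem isPure_marginal_of_excited_eq_zero {τ : QubitOp 1} (hτ : IsState τ)
    (h : τ ![1] ![1] = 0) : IsPure τ := by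
  have hcol := hτ.1.apply_eq_zero_of_diag h
  have hrow : ∀ x, τ ![1] x = 0 := fun x => by rw [← hτ.1.isHermitian.apply, hcol, star_zero]
  have h0 : τ ![0] ![0] = 1 := by
    have := hτ.2
    rw [Matrix.trace, sum_qubit_one, Fin.sum_univ_two] at this
    simpa [h] using this
  refine isPure_of_eq_vecMulVec hτ.2 (ψ := Pi.single ![0] 1) ?_
  have key : ∀ x : Fin 1 → Fin 2, x = ![0] ∨ x = ![1] := by decide
  ext x y
  rcases key x with rfl | rfl <;> rcases key y with rfl | rfl <;>
    simp [Matrix.vecMulVec_apply, h0, hcol, hrow]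

/-- On the span of `|01⟩` and `|10⟩` there is a correlation operator. -/
theorem exists_correlation_of_flip {α : QubitOp 2} (hr : α.rank = 2)
    (h00 : ∀ x, α x ![0, 0] = 0) (h11 : ∀ x, α x ![1, 1] = 0) :
    ∃ X : QubitOp 2, X.IsHermitian ∧ IsCorrelationOn X α ∧ X ≠ 0 := by
  -- Rank 2 leaves no room for further kernel vectors, so support on α only has to be tested on |00⟩
  -- and |11⟩.
  have hker : LinearMap.ker α.mulVecLin =
      Submodule.span ℂ (Set.range ![(Pi.single ![0, 0] 1 : (Fin 2 → Fin 2) → ℂ),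
        Pi.single ![1, 1] 1]) := by
    symm
    apply Submodule.eq_of_le_of_finrank_eq
    · rw [Submodule.span_le]
      rintro _ ⟨i, rfl⟩
      fin_cases i
      · ext x; simp [h00]
      · ext x; simp [h11]
    · rw [finrank_span_eq_card]
      · have := finrank_ker_add_rank α
        simp only [Fintype.card_fin]
        omega
      · rw [LinearIndependent.pair_iff]
        intro s t hst
        have e0 := congrFun hst ![0, 0]
        have e1 := congrFun hst ![1, 1]
        simp at e0 e1
        exact ⟨e0, e1⟩
  have hp : ((0, 0, 0, 0, 1) : ℝ × ℂ × ℂ × ℂ × ℂ) ≠ 0 := by simp [Prod.ext_iff]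
  -- This is |01⟩⟨10| + |10⟩⟨01|.
  refine ⟨correlationMatrix (0, 0, 0, 0, 1), correlationMatrix_isHermitian _,
    ⟨.of_isHermitian (correlationMatrix_isHermitian _) fun v hv => ?_,
      marginal_zero_correlationMatrix _, marginal_one_correlationMatrix _⟩,
    correlationMatrix_ne_zero hp⟩
  have hv' : v ∈ LinearMap.ker α.mulVecLin := by simpa using hv
  rw [hker, Matrix.range_cons, Matrix.range_cons, Matrix.range_empty, Set.union_empty,
    Set.singleton_union, Submodule.mem_span_pair] at hv'
  obtain ⟨s, t, rfl⟩ := hv'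
  have e : ∀ x, correlationMatrix (0, 0, 0, 0, 1) x ![0, 0] = 0 ∧
      correlationMatrix (0, 0, 0, 0, 1) x ![1, 1] = 0 := by
    rw [forall_qubit_two]
    simp [correlationMatrix, ofFour, finProdFinEquiv]
  ext x
  rw [mulVec_apply_two]
  simp [(e x).1, (e x).2]

theorem exists_luEquiv_corner {α : QubitOp 2} (hr : α.rank = 2) :
    ∃ α', LUEquiv α α' ∧ ∀ x, α' x ![1, 1] = 0 := by
  have hk : Module.finrank ℂ (LinearMap.ker α.mulVecLin) = 2 := by
    have := finrank_ker_add_rank α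
    omega
  obtain ⟨a, b, ha, hb, hab⟩ := exists_product_mem hk
  obtain ⟨U, hU, c, hc⟩ := exists_unitary_row ha
  obtain ⟨V, hV, d, hd⟩ := exists_unitary_row hb
  refine ⟨_, ⟨![U, V], fun i => ?_, rfl⟩, fun x => ?_⟩
  · fin_cases i
    exacts [hU, hV]
  · have h1 : (localOp ![U, V])ᴴ.col ![1, 1] = (c * d) • fun x => a (x 0) * b (x 1) := by
      ext y
      simp only [Matrix.col_apply, Matrix.conjTranspose_apply, localOp, Matrix.of_apply,
        Fin.prod_univ_two, Pi.smul_apply, smul_eq_mul, star_mul']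
      have e0 := hc (y 0)
      have e1 := hd (y 1)
      simp only [Matrix.cons_val_zero, Matrix.cons_val_one, Matrix.cons_val_fin_one]
      rw [e0, e1]
      ring
    have h2 : α *ᵥ (fun x => a (x 0) * b (x 1)) = 0 := by simpa using hab
    have h3 : (localOp ![U, V] * α * (localOp ![U, V])ᴴ).col ![1, 1] = 0 := by
      rw [← Matrix.mulVec_single_one, ← Matrix.mulVec_mulVec, Matrix.mulVec_single_one, h1,
        Matrix.mulVec_smul, ← Matrix.mulVec_mulVec, h2, Matrix.mulVec_zero, smul_zero]
    exact congrFun h3 x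

/-- Only Hermitian correlations are excluded here, since perturbations of states yield nothing more.
Both outcomes nevertheless exclude all correlations, by `noCorrelation_of_isPure_marginal` and
`noCorrelation_of_luEquiv_blockZero`. -/
theorem isPure_marginal_or_luEquiv_blockZero {α : QubitOp 2} (hα : IsState α) (hp : ¬ IsPure α)
    (hK : ∀ X : QubitOp 2, X.IsHermitian → IsCorrelationOn X α → X = 0) :
    (∃ i : Fin 2, IsPure (marginal ![i] α)) ∨
      α.rank = 2 ∧ ∃ (q₁ q₂ q₃ : ℝ) (x y z : ℂ), 0 < q₁ * q₂ * q₃ ∧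
        LUEquiv α (blockZero q₁ q₂ q₃ x y z) := by
  have hr : α.rank = 2 := by
    refine le_antisymm ?_ (two_le_rank_of_not_isPure hα hp)
    by_contra! hc
    obtain ⟨X, hX, hXc, hX0⟩ := exists_correlation_of_two_lt_rank hc
    exact hX0 (hK X hX hXc)
  obtain ⟨α', hαα', h11⟩ := exists_luEquiv_corner hr
  have hα' := hαα'.isState hα
  have hd : ∀ x, 0 ≤ (α' x x).re := fun x => (Complex.nonneg_iff.1 hα'.1.diag_nonneg).1
  have hz : ∀ x, (α' x x).re = 0 → α' x x = 0 := fun x hx => by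
    rw [← hα'.1.isHermitian.coe_re_apply_self x]
    simpa using hx
  have hmarg : ∀ i : Fin 2, IsPure (marginal ![i] α') → IsPure (marginal ![i] α) := fun i h =>
    (hαα'.symm.marginal (Function.injective_of_subsingleton _)).isPure h
  have hmst : ∀ i : Fin 2, IsState (marginal ![i] α') := fun i =>
    marginal_isState (Function.injective_of_subsingleton _) hα'
  rcases (hd ![0, 0]).eq_or_lt with h1 | h1
  -- q₁ = 0: the state lives on the span of |01⟩ and |10⟩, and the correlation there is carried back
  -- to α.
  · exfalso
    obtain ⟨X, hX, hXc, hX0⟩ := exists_correlation_of_flip (hαα'.rank_eq.trans hr)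
      (hα'.1.apply_eq_zero_of_diag (hz _ h1.symm)) h11
    obtain ⟨U, hU, hUα⟩ := hαα'.symm
    have h2 := hXc.conj hU
    rw [← hUα] at h2
    exact hX0 (conj_eq_zero hU (hK _ (Matrix.isHermitian_mul_mul_conjTranspose _ hX) h2))
  rcases (hd ![0, 1]).eq_or_lt with h2 | h2
  -- q₂ = 0: the second qubit is never in |1⟩, so its marginal is |0⟩⟨0|; the case q₃ = 0 below
  -- concerns the first qubit.
  · refine .inl ⟨1, hmarg 1 (isPure_marginal_of_excited_eq_zero (hmst 1) ?_)⟩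
    rw [marginal_one_two, Fin.sum_univ_two]
    change α' ![0, 1] ![0, 1] + α' ![1, 1] ![1, 1] = 0
    rw [h11, hz _ h2.symm, add_zero]
  rcases (hd ![1, 0]).eq_or_lt with h3 | h3
  · refine .inl ⟨0, hmarg 0 (isPure_marginal_of_excited_eq_zero (hmst 0) ?_)⟩
    rw [marginal_zero_two, Fin.sum_univ_two]
    change α' ![1, 0] ![1, 0] + α' ![1, 1] ![1, 1] = 0
    rw [h11, hz _ h3.symm, add_zero]
  have h := hαα'
  rw [eq_blockZero hα'.1.isHermitian h11] at h
  exact .inr ⟨hr, _, _, _, _, _, _, mul_pos (mul_pos h1 h2) h3, h⟩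

theorem noCorrelation_of_luEquiv_blockZero {α : QubitOp 2} (hr : α.rank = 2) {q₁ q₂ q₃ : ℝ}
    {x y z : ℂ} (hq : 0 < q₁ * q₂ * q₃) (h : LUEquiv α (blockZero q₁ q₂ q₃ x y z)) :
    NoCorrelation α := by
  refine .of_luEquiv (noCorrelation_of_corner (h.rank_eq.trans hr).le (blockZero_corner _ _ _ _ _ _)
    ?_) h
  have h1 : q₁ ≠ 0 := by rintro rfl; simp at hq
  change (q₁ : ℂ) ≠ 0
  exact_mod_cast h1

/-! ### From pairs back to the four-qubit conditions -/

theorem LUEquiv.tensor {m n : ℕ} {α α' : QubitOp m} {β β' : QubitOp n} (hα : LUEquiv α α')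
    (hβ : LUEquiv β β') : LUEquiv (tensor α β) (tensor α' β') := by
  obtain ⟨U, hU, rfl⟩ := hα
  obtain ⟨V, hV, rfl⟩ := hβ
  refine ⟨Fin.append U V, (Fin.forall_fin_add _).2 ⟨fun i => ?_, fun i => ?_⟩, ?_⟩
  · rw [Fin.append_left]; exact hU i
  · rw [Fin.append_right]; exact hV i
  · have h1 : Fin.append U V ∘ Fin.castAdd n = U := by ext1 i; simp
    have h2 : Fin.append U V ∘ Fin.natAdd m = V := by ext1 i; simp
    rw [localOp_append, h1, h2, tensor_conjTranspose, tensor_mul, tensor_mul]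

theorem LUEquiv.exists_tensor {m n : ℕ} {α : QubitOp m} {β : QubitOp n} {ρ : QubitOp (m + n)}
    (h : LUEquiv (_root_.tensor α β) ρ) :
    ∃ α' β', LUEquiv α α' ∧ LUEquiv β β' ∧ ρ = _root_.tensor α' β' := by
  obtain ⟨U, hU, rfl⟩ := h
  refine ⟨_, _, ⟨U ∘ Fin.castAdd n, fun i => hU _, rfl⟩, ⟨U ∘ Fin.natAdd m, fun i => hU _, rfl⟩, ?_⟩
  rw [localOp_append U, tensor_conjTranspose, tensor_mul, tensor_mul]

theorem noCorrelation_of_luEquiv_tensor_blockZero {α β : QubitOp 2} (hα : IsState α)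
    (hβ : IsState β) (hαr : α.rank = 2) (hβr : β.rank = 2) {p₁ p₂ p₃ q₁ q₂ q₃ : ℝ}
    {a b c x y z : ℂ} (hp : 0 < p₁ * p₂ * p₃) (hq : 0 < q₁ * q₂ * q₃)
    (h : LUEquiv (tensor α β) (tensor (blockZero p₁ p₂ p₃ a b c) (blockZero q₁ q₂ q₃ x y z))) :
    NoCorrelation α ∧ NoCorrelation β := by
  obtain ⟨α', β', hαα', hββ', heq⟩ := h.exists_tensor
  have hα' := hαα'.isState hα
  have hβ' := hββ'.isState hβ
  have h1 := congrArg (marginal ![0, 1]) heq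
  have h2 := congrArg (marginal ![2, 3]) heq
  rw [marginal_tensor_left, marginal_tensor_left, hβ'.2, one_smul] at h1
  rw [marginal_tensor_right, marginal_tensor_right, hα'.2, one_smul] at h2
  -- A tensor product determines its factors only up to scalars, so each rotated factor is a
  -- multiple t of its block; trace one forces t ≠ 0, and the corner argument tolerates the scalar.
  have key : ∀ {τ τ' : QubitOp 2} {t : ℂ} {q₁ q₂ q₃ : ℝ} {x y z : ℂ}, IsState τ' → τ.rank = 2 →
      0 < q₁ * q₂ * q₃ → LUEquiv τ τ' → t • blockZero q₁ q₂ q₃ x y z = τ' → NoCorrelation τ := by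
    intro τ τ' t q₁ q₂ q₃ x y z hτ' hr hq hτ ht
    have hq1 : (q₁ : ℂ) ≠ 0 := by
      norm_cast
      rintro rfl
      simp at hq
    have ht0 : t ≠ 0 := by
      rintro rfl
      rw [zero_smul] at ht
      have := hτ'.2
      rw [← ht, Matrix.trace_zero] at this
      exact zero_ne_one this
    refine .of_luEquiv (noCorrelation_of_corner (hτ.rank_eq.trans hr).le (fun i => ?_) ?_) hτ
    · rw [← ht, Matrix.smul_apply, blockZero_corner, smul_zero]
    · rw [← ht]
      exact mul_ne_zero ht0 hq1
  exact ⟨key hα' hαr hp hαα' h1, key hβ' hβr hq hββ' h2⟩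

theorem isUnit_of_not_isPure {τ : QubitOp 1} (hτ : IsState τ) (hp : ¬ IsPure τ) : IsUnit τ := by
  rw [Matrix.isUnit_iff_isUnit_det, hτ.1.isHermitian.det_eq_prod_eigenvalues, isUnit_iff_ne_zero]
  obtain ⟨i, j, hij, hi, hj⟩ := exists_two_eigenvalues hτ hp
  have key : ∀ i j k : Fin 1 → Fin 2, i ≠ j → k = i ∨ k = j := by decide
  refine Finset.prod_ne_zero_iff.2 fun k _ => ?_
  rcases key i j k hij with rfl | rfl
  · simpa using hi
  · simpa using hj

/-- The product of invertible one-qubit operators is invertible, of rank 4. In condition (iii) this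
prevents m₁ and m₂ from lying in different pairs. -/
theorem rank_tensor_ne_two {τ υ : QubitOp 1} (hτ : IsUnit τ) (hυ : IsUnit υ) :
    Matrix.rank (tensor τ υ : QubitOp 2) ≠ 2 := by
  obtain ⟨a, ha⟩ := hτ.exists_right_inv
  obtain ⟨b, hb⟩ := hυ.exists_right_inv
  have h1 : tensor τ υ * tensor a b = 1 := by
    rw [tensor_mul, ha, hb, tensor_eq_kronecker]
    exact (congrArg (fun M => Matrix.submatrix M _ _) Matrix.one_kronecker_one).trans
      (Matrix.submatrix_one_equiv _)
  have h2 : Matrix.rank (tensor τ υ) = Fintype.card (Fin (1 + 1) → Fin 2) :=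
    Matrix.rank_of_isUnit _ (.of_mul_eq_one _ h1)
  intro h
  have h3 : Fintype.card (Fin (1 + 1) → Fin 2) = 4 := by simp
  rw [h3] at h2
  exact absurd (h.symm.trans h2) (by norm_num)

theorem rank_marginal_swap {n : ℕ} (i j : Fin n) (ρ : QubitOp n) :
    (marginal ![j, i] ρ).rank = (marginal ![i, j] ρ).rank := by
  rw [marginal_swap]
  exact Matrix.rank_submatrix _ ((Equiv.swap 0 1).arrowCongr (Equiv.refl (Fin 2)))
    ((Equiv.swap 0 1).arrowCongr (Equiv.refl (Fin 2)))

theorem marginal_swap_two (α : QubitOp 2) (i : Fin 2) :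
    marginal ![i] (α.submatrix (· ∘ Equiv.swap 0 1) (· ∘ Equiv.swap 0 1)) =
      marginal ![Equiv.swap 0 1 i] α := by
  have hs : ∀ a b : Fin 2, (![a, b] ∘ Equiv.swap 0 1 : Fin 2 → Fin 2) = ![b, a] := by decide
  ext a b
  fin_cases i
  · change marginal ![0] _ a b = marginal ![1] α a b
    simp only [marginal_zero_two, marginal_one_two, Matrix.submatrix_apply, hs]
  · change marginal ![1] _ a b = marginal ![0] α a b
    simp only [marginal_zero_two, marginal_one_two, Matrix.submatrix_apply, hs]

theorem NoCorrelation.of_swap {α : QubitOp 2}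
    (h : NoCorrelation (α.submatrix (· ∘ Equiv.swap 0 1) (· ∘ Equiv.swap 0 1))) :
    NoCorrelation α := by
  set e : (Fin 2 → Fin 2) ≃ (Fin 2 → Fin 2) := (Equiv.swap 0 1).arrowCongr (Equiv.refl (Fin 2))
  have key : ∀ (Y : QubitOp 2) (v : (Fin 2 → Fin 2) → ℂ),
      Y.submatrix e e *ᵥ v = 0 ↔ Y *ᵥ (v ∘ e.symm) = 0 := by
    intro Y v
    rw [Matrix.submatrix_mulVec_equiv]
    exact ⟨fun h => e.surjective.injective_comp_right h, fun h => by rw [h]; rfl⟩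
  intro X hX
  have h0 : X.submatrix e e = 0 := by
    refine h _ ⟨⟨fun v hv => (key _ _).2 (hX.1.1 _ ((key _ _).1 hv)), fun v hv => ?_⟩, ?_, ?_⟩
    · rw [Matrix.conjTranspose_submatrix]
      exact (key _ _).2 (hX.1.2 _ ((key _ _).1 hv))
    · exact (marginal_swap_two X 0).trans (hX.marginal_eq_zero _)
    · exact (marginal_swap_two X 1).trans (hX.marginal_eq_zero _)
  ext x y
  simpa using congrFun (congrFun h0 (e.symm x)) (e.symm y)

section Factors

variable {α β : QubitOp 2}

theorem marginal_castAdd_tensor (hβ : IsState β) (i : Fin 2) :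
    marginal ![Fin.castAdd 2 i] (tensor α β) = marginal ![i] α := by
  have h := marginal_tensor_castAdd ![i] α β
  rw [hβ.2, one_smul] at h
  rw [← h]
  congr 1
  ext k; fin_cases k; rfl

theorem marginal_natAdd_tensor (hα : IsState α) (i : Fin 2) :
    marginal ![Fin.natAdd 2 i] (tensor α β) = marginal ![i] β := by
  have h := marginal_tensor_natAdd ![i] α β
  rw [hα.2, one_smul] at h
  rw [← h]
  congr 1
  ext k; fin_cases k; rfl

theorem noCorrelation_of_marginal_pair {ρ : QubitOp 4} {m₁ m₂ : Fin 4} {τ : QubitOp 2}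
    (h : marginal ![m₁, m₂] ρ = τ ∨ marginal ![m₂, m₁] ρ = τ)
    (hr : (marginal ![m₁, m₂] ρ).rank = 2) {q₁ q₂ q₃ : ℝ} {x y z : ℂ} (hq : 0 < q₁ * q₂ * q₃)
    (hLU : LUEquiv (marginal ![m₁, m₂] ρ) (blockZero q₁ q₂ q₃ x y z)) : NoCorrelation τ := by
  have hN := noCorrelation_of_luEquiv_blockZero hr hq hLU
  rcases h with rfl | rfl
  · exact hN
  · rw [marginal_swap] at hN
    exact hN.of_swap

theorem rank_marginal_mixed_ne_two (hα : IsState α) (hβ : IsState β) {i k : Fin 2}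
    (hi : ¬ IsPure (marginal ![Fin.castAdd 2 i] (tensor α β)))
    (hk : ¬ IsPure (marginal ![Fin.natAdd 2 k] (tensor α β))) :
    (marginal ![Fin.castAdd 2 i, Fin.natAdd 2 k] (tensor α β)).rank ≠ 2 := by
  rw [marginal_castAdd_tensor hβ] at hi
  rw [marginal_natAdd_tensor hα] at hk
  rw [marginal_tensor_pair]
  exact rank_tensor_ne_two
    (isUnit_of_not_isPure (marginal_isState (Function.injective_of_subsingleton _) hα) hi)
    (isUnit_of_not_isPure (marginal_isState (Function.injective_of_subsingleton _) hβ) hk)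

theorem four_sites_cases : ∀ j m₁ m₂ : Fin 4, j ≠ m₁ → j ≠ m₂ → m₁ ≠ m₂ →
    ((∃ i : Fin 2, j = Fin.castAdd 2 i) ∧ (m₁ = 2 ∧ m₂ = 3 ∨ m₁ = 3 ∧ m₂ = 2)) ∨
    ((∃ i : Fin 2, j = Fin.natAdd 2 i) ∧ (m₁ = 0 ∧ m₂ = 1 ∨ m₁ = 1 ∧ m₂ = 0)) ∨
    ∃ i k : Fin 2, m₁ = Fin.castAdd 2 i ∧ m₂ = Fin.natAdd 2 k ∨
      m₁ = Fin.natAdd 2 k ∧ m₂ = Fin.castAdd 2 i := by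
  decide

/-- If m₁ and m₂ lay in different pairs, their marginal would be a product of two mixed qubits, of
rank 4. So they form the pair not containing j, in either order: that factor is excluded by its
block form, the other by its pure marginal. -/
theorem noCorrelation_of_one_isPure_marginal (hα : IsState α) (hβ : IsState β)
    {j m₁ m₂ : Fin 4} (hm₁ : j ≠ m₁) (hm₂ : j ≠ m₂) (hm : m₁ ≠ m₂)
    (hj : IsPure (marginal ![j] (tensor α β)))
    (hi : ∀ i, i ≠ j → ¬ IsPure (marginal ![i] (tensor α β)))
    (hr : (marginal ![m₁, m₂] (tensor α β)).rank = 2) {q₁ q₂ q₃ : ℝ} {x y z : ℂ}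
    (hq : 0 < q₁ * q₂ * q₃)
    (hLU : LUEquiv (marginal ![m₁, m₂] (tensor α β)) (blockZero q₁ q₂ q₃ x y z)) :
    NoCorrelation α ∧ NoCorrelation β := by
  have hl : marginal ![0, 1] (tensor α β) = α := by rw [marginal_tensor_left, hβ.2, one_smul]
  have hr' : marginal ![2, 3] (tensor α β) = β := by rw [marginal_tensor_right, hα.2, one_smul]
  rcases four_sites_cases j m₁ m₂ hm₁ hm₂ hm with
    ⟨⟨i, rfl⟩, h⟩ | ⟨⟨i, rfl⟩, h⟩ | ⟨i, k, ⟨rfl, rfl⟩ | ⟨rfl, rfl⟩⟩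
  · rw [marginal_castAdd_tensor hβ] at hj
    refine ⟨noCorrelation_of_isPure_marginal hα.1 hj, noCorrelation_of_marginal_pair ?_ hr hq hLU⟩
    rcases h with ⟨rfl, rfl⟩ | ⟨rfl, rfl⟩
    exacts [.inl hr', .inr hr']
  · rw [marginal_natAdd_tensor hα] at hj
    refine ⟨noCorrelation_of_marginal_pair ?_ hr hq hLU, noCorrelation_of_isPure_marginal hβ.1 hj⟩
    rcases h with ⟨rfl, rfl⟩ | ⟨rfl, rfl⟩
    exacts [.inl hl, .inr hl]
  · exact absurd hr (rank_marginal_mixed_ne_two hα hβ (hi _ hm₁.symm) (hi _ hm₂.symm))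
  · rw [rank_marginal_swap] at hr
    exact absurd hr (rank_marginal_mixed_ne_two hα hβ (hi _ hm₂.symm) (hi _ hm₁.symm))

theorem comp_single {m n : ℕ} (x : Fin n → Fin 2) (f : Fin m → Fin n) (i : Fin m) :
    (x ∘ f) ∘ ![i] = x ∘ ![f i] := by
  ext1 k; fin_cases k; rfl

/-- The pure marginal splits α into a product, giving the threefold factorization. The partner qubit
cannot be pure as well, since α would then be pure. -/
theorem one_isPure_marginal_left (hα : IsState α) (hβ : IsState β) (hp : ¬ IsPure α) {i : Fin 2}
    (hi : IsPure (marginal ![i] α)) (hβm : ∀ k : Fin 2, ¬ IsPure (marginal ![k] β)) :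
    ∃ n : Fin 4, Function.Injective ![Fin.castAdd 2 i, n, 2, 3] ∧
      (∀ l, l ≠ Fin.castAdd 2 i → ¬ IsPure (marginal ![l] (tensor α β))) ∧
      ∀ x y, tensor α β x y =
        marginal ![Fin.castAdd 2 i] (tensor α β) (x ∘ ![Fin.castAdd 2 i]) (y ∘ ![Fin.castAdd 2 i]) *
          marginal ![n] (tensor α β) (x ∘ ![n]) (y ∘ ![n]) *
          marginal ![2, 3] (tensor α β) (x ∘ ![2, 3]) (y ∘ ![2, 3]) := by
  obtain ⟨j, hij⟩ : ∃ j, i ≠ j := (by decide : ∀ i : Fin 2, ∃ j, i ≠ j) i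
  refine ⟨Fin.castAdd 2 j, ?_, (Fin.forall_fin_add _).2 ⟨fun l hl => ?_, fun l _ => ?_⟩,
    fun x y => ?_⟩
  · clear * - hij
    revert i j
    decide
  · rw [marginal_castAdd_tensor hβ]
    have hil : i ≠ l := fun h => hl (by rw [h])
    exact fun h => hp (isPure_of_isPure_marginals hα hil hi h)
  · rw [marginal_natAdd_tensor hα]
    exact hβm l
  · have hc : (Fin.natAdd 2 : Fin 2 → Fin (2 + 2)) = ![2, 3] := by decide
    rw [marginal_castAdd_tensor hβ, marginal_castAdd_tensor hβ, marginal_tensor_right, hα.2,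
      one_smul, ← comp_single, ← comp_single, ← comp_single x, ← comp_single y,
      ← eq_marginal_mul_marginal hα.1 hij hi]
    exact congrArg (fun s => _ * β (x ∘ s) (y ∘ s)) hc

theorem one_isPure_marginal_right (hα : IsState α) (hβ : IsState β) (hp : ¬ IsPure β) {i : Fin 2}
    (hi : IsPure (marginal ![i] β)) (hαm : ∀ k : Fin 2, ¬ IsPure (marginal ![k] α)) :
    ∃ n : Fin 4, Function.Injective ![Fin.natAdd 2 i, n, 0, 1] ∧
      (∀ l, l ≠ Fin.natAdd 2 i → ¬ IsPure (marginal ![l] (tensor α β))) ∧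
      ∀ x y, tensor α β x y =
        marginal ![Fin.natAdd 2 i] (tensor α β) (x ∘ ![Fin.natAdd 2 i]) (y ∘ ![Fin.natAdd 2 i]) *
          marginal ![n] (tensor α β) (x ∘ ![n]) (y ∘ ![n]) *
          marginal ![0, 1] (tensor α β) (x ∘ ![0, 1]) (y ∘ ![0, 1]) := by
  obtain ⟨j, hij⟩ : ∃ j, i ≠ j := (by decide : ∀ i : Fin 2, ∃ j, i ≠ j) i
  refine ⟨Fin.natAdd 2 j, ?_, (Fin.forall_fin_add _).2 ⟨fun l _ => ?_, fun l hl => ?_⟩,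
    fun x y => ?_⟩
  · clear * - hij
    revert i j
    decide
  · rw [marginal_castAdd_tensor hβ]
    exact hαm l
  · rw [marginal_natAdd_tensor hα]
    have hil : i ≠ l := fun h => hl (by rw [h])
    exact fun h => hp (isPure_of_isPure_marginals hβ hil hi h)
  · have hc : (Fin.castAdd 2 : Fin 2 → Fin (2 + 2)) = ![0, 1] := by decide
    rw [marginal_natAdd_tensor hα, marginal_natAdd_tensor hα, marginal_tensor_left, hβ.2,
      one_smul, ← comp_single, ← comp_single, ← comp_single x, ← comp_single y,
      ← eq_marginal_mul_marginal hβ.1 hij hi, mul_comm]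
    exact congrArg (fun s => α (x ∘ s) (y ∘ s) * _) hc

theorem exists_isPure_marginal_left_iff (hβ : IsState β) :
    (∃ i : Fin 2, IsPure (marginal ![i] α)) ↔
      IsPure (marginal ![(0 : Fin 4)] (tensor α β)) ∨
        IsPure (marginal ![(1 : Fin 4)] (tensor α β)) := by
  rw [Fin.exists_fin_two, ← marginal_castAdd_tensor (α := α) hβ,
    ← marginal_castAdd_tensor (α := α) hβ]
  rfl

theorem exists_isPure_marginal_right_iff (hα : IsState α) :
    (∃ i : Fin 2, IsPure (marginal ![i] β)) ↔
      IsPure (marginal ![(2 : Fin 4)] (tensor α β)) ∨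
        IsPure (marginal ![(3 : Fin 4)] (tensor α β)) := by
  rw [Fin.exists_fin_two, ← marginal_natAdd_tensor (β := β) hα,
    ← marginal_natAdd_tensor (β := β) hα]
  rfl

end Factors

theorem mainTheorem2 (α β : QubitOp 2) (hα : IsState α) (hβ : IsState β)
    (ρ : QubitOp 4) (hρ : ρ = tensor α β) :
    IsUDA 2 ρ ↔
      -- one of the two factors is pure
      (IsPure α ∨ IsPure β) ∨
      -- each factor has a pure one-qubit marginal
      ((IsPure (marginal ![0] ρ) ∨ IsPure (marginal ![1] ρ)) ∧
        (IsPure (marginal ![2] ρ) ∨ IsPure (marginal ![3] ρ))) ∨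
      -- exactly one one-qubit marginal is pure
      (∃ j n m₁ m₂ : Fin 4, Function.Injective ![j, n, m₁, m₂] ∧
        IsPure (marginal ![j] ρ) ∧ (∀ i, i ≠ j → ¬ IsPure (marginal ![i] ρ)) ∧
        (∀ x y, ρ x y = marginal ![j] ρ (x ∘ ![j]) (y ∘ ![j]) *
          marginal ![n] ρ (x ∘ ![n]) (y ∘ ![n]) *
          marginal ![m₁, m₂] ρ (x ∘ ![m₁, m₂]) (y ∘ ![m₁, m₂])) ∧
        (marginal ![m₁, m₂] ρ).rank = 2 ∧
        ∃ (q₁ q₂ q₃ : ℝ) (x y z : ℂ), 0 < q₁ * q₂ * q₃ ∧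
          LUEquiv (marginal ![m₁, m₂] ρ) (blockZero q₁ q₂ q₃ x y z)) ∨
      -- both factors have rank two
      (α.rank = 2 ∧ β.rank = 2 ∧
        ∃ (p₁ p₂ p₃ q₁ q₂ q₃ : ℝ) (a b c x y z : ℂ),
          0 < p₁ * p₂ * p₃ ∧ 0 < q₁ * q₂ * q₃ ∧
          LUEquiv ρ (tensor (blockZero p₁ p₂ p₃ a b c) (blockZero q₁ q₂ q₃ x y z))) := by
  subst hρ
  rw [← exists_isPure_marginal_left_iff hβ, ← exists_isPure_marginal_right_iff hα]
  constructor
  · intro hU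
    by_cases hpα : IsPure α
    · exact .inl (.inl hpα)
    by_cases hpβ : IsPure β
    · exact .inl (.inr hpβ)
    right
    have hA := isPure_marginal_or_luEquiv_blockZero hα hpα fun X hX hc =>
      hU.correlation_eq_zero_left hα hβ hpβ hX hc
    have hB := isPure_marginal_or_luEquiv_blockZero hβ hpβ fun X hX hc =>
      hU.correlation_eq_zero_right hα hβ hpα hX hc
    by_cases hmα : ∃ i : Fin 2, IsPure (marginal ![i] α)
    · by_cases hmβ : ∃ i : Fin 2, IsPure (marginal ![i] β)
      · exact .inl ⟨hmα, hmβ⟩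
      obtain ⟨hr, q₁, q₂, q₃, x, y, z, hq, hLU⟩ := hB.resolve_left hmβ
      obtain ⟨i, hi⟩ := hmα
      obtain ⟨n, hn, hl, hprod⟩ := one_isPure_marginal_left hα hβ hpα hi (not_exists.1 hmβ)
      have hm : marginal ![2, 3] (tensor α β) = β := by rw [marginal_tensor_right, hα.2, one_smul]
      refine .inr (.inl ⟨Fin.castAdd 2 i, n, 2, 3, hn, ?_, hl, hprod, ?_, q₁, q₂, q₃, x, y, z, hq,
        ?_⟩)
      · rwa [marginal_castAdd_tensor hβ]
      · rwa [hm]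
      · rwa [hm]
    · obtain ⟨hr, p₁, p₂, p₃, a, b, c, hp, hLU⟩ := hA.resolve_left hmα
      by_cases hmβ : ∃ i : Fin 2, IsPure (marginal ![i] β)
      · obtain ⟨i, hi⟩ := hmβ
        obtain ⟨n, hn, hl, hprod⟩ := one_isPure_marginal_right hα hβ hpβ hi (not_exists.1 hmα)
        have hm : marginal ![0, 1] (tensor α β) = α := by rw [marginal_tensor_left, hβ.2, one_smul]
        refine .inr (.inl ⟨Fin.natAdd 2 i, n, 0, 1, hn, ?_, hl, hprod, ?_, p₁, p₂, p₃, a, b, c, hp,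
          ?_⟩)
        · rwa [marginal_natAdd_tensor hα]
        · rwa [hm]
        · rwa [hm]
      obtain ⟨hr', q₁, q₂, q₃, x, y, z, hq, hLU'⟩ := hB.resolve_left hmβ
      exact .inr (.inr ⟨hr, hr', p₁, p₂, p₃, q₁, q₂, q₃, a, b, c, x, y, z, hp, hq,
        hLU.tensor hLU'⟩)
  · rintro ((h | h) | ⟨⟨i, hi⟩, k, hk⟩ |
      ⟨j, n, m₁, m₂, hinj, hj, hl, -, hr, q₁, q₂, q₃, x, y, z, hq, hLU⟩ |
      ⟨hr, hr', p₁, p₂, p₃, q₁, q₂, q₃, a, b, c, x, y, z, hp, hq, hLU⟩)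
    · exact isUDA_of_isPure_left hα hβ h
    · exact isUDA_of_isPure_right hα hβ h
    · exact isUDA_of_noCorrelation hα hβ (noCorrelation_of_isPure_marginal hα.1 hi)
        (noCorrelation_of_isPure_marginal hβ.1 hk)
    · have h02 : j ≠ m₁ := hinj.ne (by decide : (0 : Fin 4) ≠ 2)
      have h03 : j ≠ m₂ := hinj.ne (by decide : (0 : Fin 4) ≠ 3)
      have h23 : m₁ ≠ m₂ := hinj.ne (by decide : (2 : Fin 4) ≠ 3)
      obtain ⟨hA, hB⟩ := noCorrelation_of_one_isPure_marginal hα hβ h02 h03 h23 hj hl hr hq hLU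
      exact isUDA_of_noCorrelation hα hβ hA hB
    · obtain ⟨hA, hB⟩ := noCorrelation_of_luEquiv_tensor_blockZero hα hβ hr hr' hp hq hLU
      exact isUDA_of_noCorrelation hα hβ hA hB
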